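/- All graphs are finite and simple. A graph is 2-connected if it has at least three vertices, is connected, and remains connected after deleting any single vertex; it is subcubic if every vertex has degree at most $3$. Let $G$ be a 2-connected subcubic graph, let $S \subseteq E(G)$, and let $k \ge 0$ be an integer. If $|S| \ge 2^{4k^2}$, then there exists a path $P$ in $G$ such that $|E(P) \cap S| \ge k$. -/

import Mathlib

namespace SimpleGraph

/-- A graph is 2-connected if it has at least three vertices, is connected, and stays connected
after the deletion of any one vertex. -/
def IsTwoConnected {V : Type*} [Fintype V] (G : SimpleGraph V) : Prop :=
  3 ≤ Fintype.card V ∧ G.Connected ∧ ∀ v : V, (G.induce {w | w ≠ v}).Connected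

/-- A graph is subcubic if every vertex has degree at most three. -/
def IsSubcubic {V : Type*} [Fintype V] (G : SimpleGraph V) [DecidableRel G.Adj] : Prop :=
  ∀ v : V, G.degree v ≤ 3

end SimpleGraph

/-! Grow a path `v 0, …, v n` greedily. The part still unexplored is the component of `v n` after
deleting `v 0, …, v (n - 1)`. Since `G` is subcubic, at most two neighbours of `v n` lie in it, so
deleting `v n` as well leaves at most two pieces to continue in, and a piece richest in edges of `S`
is kept. The supply of marked edges ahead shrinks, by a factor of about two, only when the path
itself traverses a marked edge, or when the abandoned piece, with its edge to `v n`, contains one.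
In the latter case 2-connectivity gives an ear through that marked edge, from `v n` across the
abandoned piece back to an earlier path vertex: a chord. This is `IsSearch.exists_succ`.

When no marked edge is left ahead, `|S| ≤ 3 * 2 ^ (f + c)`, with `f` chords and `c` marked edges on
the path. If `c ≥ k`, the path itself is the answer; otherwise `f > 4 (k - 1)² + 2`. By the degree
bound at most two chords end at `v 0`, and the others have distinct lower ends. Erdős–Szekeres then
yields either `k` nested chords, which all lie on a spiral, or more than `4 (k - 1)` chords whose
two ends increase together, a quarter of which lie on a zigzag (`Route.exists_of_card`).
Disjointness of the ears turns such a route into a path of `G` (`IsChordedPath.exists_isPath`). -/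

open Set

/-! ### Routes through chords over an interval of integers -/

/-- Routes along the path `0, 1, …, m` with chords joining `a t` and `t` for `t ∈ F`: `Route m F a i j I J`
says that one can go from `i` to `j` inside `I` using exactly the chords in `J`. -/
inductive Route (m : ℕ) (F : Finset ℕ) (a : ℕ → ℕ) : ℕ → ℕ → Set ℕ → Finset ℕ → Prop
  | up {i j : ℕ} (hij : i ≤ j) (hj : j ≤ m) : Route m F a i j (Icc i j) ∅
  | chord {t : ℕ} (ht : t ∈ F) : Route m F a (a t) t {a t, t} {t}
  | symm {i j : ℕ} {I : Set ℕ} {J : Finset ℕ} (h : Route m F a i j I J) : Route m F a j i I J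
  | trans {i j l : ℕ} {I I' : Set ℕ} {J J' : Finset ℕ} (h : Route m F a i j I J)
      (h' : Route m F a j l I' J') (hI : I ∩ I' ⊆ {j}) (hJ : Disjoint J J') :
      Route m F a i l (I ∪ I') (J ∪ J')

/-- A strictly decreasing choice of lower ends gives nested chords, all of which lie on one route. -/
theorem Route.exists_of_strictAntiOn {m : ℕ} {F : Finset ℕ} {a : ℕ → ℕ}
    (ha : ∀ t ∈ F, a t < t) (hm : ∀ t ∈ F, t ≤ m) (A : Finset ℕ) (hAF : A ⊆ F)
    (hA : StrictAntiOn a A) (x : ℕ) (hx : x ∈ A) (hmax : ∀ t ∈ A, t ≤ x) :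
    (∃ j I, I ⊆ Icc (a x) x ∧ Route m F a x j I A) ∧
      ∃ j I, I ⊆ Icc (a x) x ∧ Route m F a (a x) j I A := by
  induction A using Finset.strongInduction generalizing x with
  | H A ih =>
    have hxF := hAF hx
    have hax := ha x hxF
    have hxm := hm x hxF
    rcases (A.erase x).eq_empty_or_nonempty with he | he
    · have hAx : A = {x} := by
        rw [← Finset.insert_erase hx, he]
        rfl
      subst hAx
      exact ⟨⟨_, _, by rintro z (rfl | rfl) <;> simp [hax.le], (Route.chord hxF).symm⟩,
        ⟨_, _, by rintro z (rfl | rfl) <;> simp [hax.le], Route.chord hxF⟩⟩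
    · obtain ⟨y, hy, hymax⟩ : ∃ y ∈ A.erase x, ∀ t ∈ A.erase x, t ≤ y :=
        ⟨_, Finset.max'_mem _ he, fun t ht => Finset.le_max' _ t ht⟩
      have hyA := Finset.mem_of_mem_erase hy
      have hyx : y < x := lt_of_le_of_ne (hmax y hyA) (Finset.ne_of_mem_erase hy)
      have haxy : a x < a y := hA hyA hx hyx
      have hay := ha y (hAF hyA)
      obtain ⟨⟨j, I, hI, hR⟩, ⟨j', I', hI', hR'⟩⟩ := ih _ (Finset.erase_ssubset hx)
        ((Finset.erase_subset _ _).trans hAF)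
        (hA.mono (by exact_mod_cast Finset.erase_subset _ _)) y hy hymax
      have hJ : Disjoint ({x} : Finset ℕ) (A.erase x) := by simp
      have hU : ({x} ∪ ∅ : Finset ℕ) ∪ A.erase x = A := by
        simpa using Finset.insert_erase hx
      -- The spiral: from `x`, cross the outermost chord to `a x`, climb to `a y` and enter the
      -- inner nest at its lower end. From `a x`, cross to `x`, descend to `y` and enter at the
      -- upper end. Each case calls on the other, hence the double conclusion.
      constructor
      · have h1 := (Route.chord hxF).symm.trans (Route.up (a := a) (F := F) haxy.le (by omega : a y ≤ m))
          (by rintro z ⟨rfl | rfl, h1, h2⟩ <;> (simp; try omega)) (by simp)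
        have h2 := h1.trans hR' (by
          rintro z ⟨(rfl | rfl) | h3, h4⟩ <;> have := hI' h4 <;>
            simp only [mem_Icc, mem_singleton_iff] at * <;> omega) (by simp)
        rw [hU] at h2
        refine ⟨_, _, ?_, h2⟩
        rintro z (((rfl | rfl) | h3) | h4)
        · simp [hax.le]
        · simp [hax.le]
        · simp only [mem_Icc] at *
          omega
        · have := hI' h4
          simp only [mem_Icc] at *
          omega
      · have h1 := (Route.chord hxF).trans (Route.up (a := a) (F := F) hyx.le hxm).symm
          (by rintro z ⟨rfl | rfl, h1, h2⟩ <;> (simp; try omega)) (by simp)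
        have h2 := h1.trans hR (by
          rintro z ⟨(rfl | rfl) | h3, h4⟩ <;> have := hI h4 <;>
            simp only [mem_Icc, mem_singleton_iff] at * <;> omega) (by simp)
        rw [hU] at h2
        refine ⟨_, _, ?_, h2⟩
        rintro z (((rfl | rfl) | h3) | h4)
        · simp [hax.le]
        · simp [hax.le]
        · simp only [mem_Icc] at *
          omega
        · have := hI h4
          simp only [mem_Icc] at *
          omega

/-- Pairwise crossing chords: a route towards the right uses at least half of them. -/
theorem Route.exists_of_crossing {m : ℕ} {F : Finset ℕ} {a : ℕ → ℕ}
    (hm : ∀ t ∈ F, t ≤ m) (c : ℕ) (A : Finset ℕ) (hAF : A ⊆ F)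
    (hA : StrictMonoOn a A) (hac : ∀ t ∈ A, a t < c) (hc : ∀ t ∈ A, c ≤ t)
    (x : ℕ) (hx : x ∈ A) (hmin : ∀ t ∈ A, x ≤ t) :
    ∃ y ∈ A, ∃ I J, I ⊆ Ico (a x) c ∪ Icc x y ∧ J ⊆ A ∧ A.card ≤ 2 * J.card ∧
      Route m F a (a x) y I J := by
  induction A using Finset.strongInduction generalizing x with
  | H A ih =>
    have hxF := hAF hx
    have hcx := hc x hx
    have hacx := hac x hx
    rcases ((A.erase x)).eq_empty_or_nonempty with he | he
    · have hAx : A = {x} := by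
        rw [← Finset.insert_erase hx, he]
        rfl
      subst hAx
      exact ⟨x, hx, _, _, by rintro z (rfl | rfl) <;> simp [hacx], by simp, by simp,
        Route.chord hxF⟩
    obtain ⟨y, hy, hymin⟩ : ∃ y ∈ A.erase x, ∀ t ∈ A.erase x, y ≤ t :=
      ⟨_, Finset.min'_mem _ he, fun t ht => Finset.min'_le _ t ht⟩
    have hyA := Finset.mem_of_mem_erase hy
    have hxy : x < y := lt_of_le_of_ne (hmin y hyA) (Finset.ne_of_mem_erase hy).symm
    have haxy : a x < a y := hA hx hyA hxy
    have hcard1 := Finset.card_erase_add_one hx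
    have hcard2 := Finset.card_erase_add_one hy
    rcases ((A.erase x).erase y).eq_empty_or_nonempty with he2 | he2
    -- With two chords left only one is used: the route has to finish at an upper end so that it can
    -- be continued to the right.
    · rw [he2] at hcard2
      exact ⟨x, hx, _, _, by rintro z (rfl | rfl) <;> simp [hacx], by simpa using hx,
        by simp at hcard2 ⊢; omega, Route.chord hxF⟩
    obtain ⟨w, hw, hwmin⟩ : ∃ w ∈ (A.erase x).erase y, ∀ t ∈ (A.erase x).erase y, w ≤ t :=
      ⟨_, Finset.min'_mem _ he2, fun t ht => Finset.min'_le _ t ht⟩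
    have hw' := Finset.mem_of_mem_erase hw
    have hwA := Finset.mem_of_mem_erase hw'
    have hyw : y < w := lt_of_le_of_ne (hymin w hw') (Finset.ne_of_mem_erase hw).symm
    have hayw : a y < a w := hA hyA hwA hyw
    have hsub : (A.erase x).erase y ⊂ A :=
      (Finset.erase_ssubset hy).trans (Finset.erase_ssubset hx)
    obtain ⟨z, hz, I, J, hI, hJ, hcard, hR⟩ := ih _ hsub (hsub.subset.trans hAF)
      (hA.mono (by exact_mod_cast hsub.subset)) (fun t ht => hac t (hsub.subset ht))
      (fun t ht => hc t (hsub.subset ht)) w hw hwmin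
    have hwz := hwmin z hz
    have hacw := hac w hwA
    have hwm := hm w (hAF hwA)
    -- Zigzag: over the chord to `x`, up to `y`, back over the chord to `a y`, up to `a w`, and
    -- recurse on the chords from `w` on.
    have h1 := (Route.chord hxF).trans (Route.up (a := a) (F := F) hxy.le (by omega : y ≤ m))
      (by rintro z ⟨rfl | rfl, h1, h2⟩ <;> (simp; try omega)) (by simp)
    have h2 := h1.trans (Route.chord (hAF hyA)).symm (by
      rintro z ⟨(rfl | rfl) | h3, (h4 | h4)⟩ <;>
        simp only [mem_Icc, mem_singleton_iff] at * <;> omega) (by simpa using hxy.ne)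
    have h3 := h2.trans (Route.up (a := a) (F := F) hayw.le (by omega : a w ≤ m)) (by
      rintro z ⟨((rfl | rfl) | h3) | (rfl | rfl), h4⟩ <;>
        simp only [mem_Icc, mem_singleton_iff] at * <;> omega) (by simp)
    have hxJ : x ∉ J := fun h => by simpa using hJ h
    have hyJ : y ∉ J := fun h => by simpa using hJ h
    have h4 := h3.trans hR (by
      rintro z ⟨(((rfl | rfl) | h3) | (rfl | rfl)) | h3, h4⟩ <;> have := hI h4 <;>
        simp only [mem_Icc, mem_Ico, mem_union, mem_singleton_iff] at * <;> omega)
        (by simp [hxJ, hyJ])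
    refine ⟨z, hsub.subset hz, _, _, ?_, ?_, ?_, h4⟩
    · rintro z (((((rfl | rfl) | h3) | (rfl | rfl)) | h3) | h4)
      on_goal 7 => have := hI h4
      all_goals
        simp only [mem_Icc, mem_Ico, mem_union] at *
        omega
    · intro u hu
      simp only [Finset.mem_union, Finset.mem_singleton, Finset.notMem_empty, or_false] at hu
      rcases hu with (rfl | rfl) | hu
      · exact hx
      · exact hyA
      · exact hsub.subset (hJ hu)
    · have : (((({x} ∪ ∅ : Finset ℕ) ∪ {y}) ∪ ∅) ∪ J) = insert x (insert y J) := by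
        ext u
        simp
      rw [this, Finset.card_insert_of_notMem (by simp [hxJ, hxy.ne]), Finset.card_insert_of_notMem hyJ]
      omega

/-- From every starting point left of the chords in `A`, some route to the right uses at least `n` chords of `A`. -/
def Route.Achieves (m : ℕ) (F : Finset ℕ) (a : ℕ → ℕ) (A : Finset ℕ) (n : ℕ) : Prop :=
  ∀ i ≤ m, (∀ t ∈ A, i ≤ a t) →
    ∃ j I J, I ⊆ Ici i ∧ J ⊆ A ∧ n ≤ J.card ∧ Route m F a i j I J

theorem Route.Achieves.mono {m n : ℕ} {F : Finset ℕ} {a : ℕ → ℕ} {A B : Finset ℕ} (hAB : A ⊆ B)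
    (h : Route.Achieves m F a A n) : Route.Achieves m F a B n := fun i hi hB => by
  obtain ⟨j, I, J, hI, hJ, hn, hR⟩ := h i hi fun t ht => hB t (hAB ht)
  exact ⟨j, I, J, hI, hJ.trans hAB, hn, hR⟩

theorem Route.achieves_zero {m : ℕ} {F : Finset ℕ} {a : ℕ → ℕ} (A : Finset ℕ) :
    Route.Achieves m F a A 0 := fun i hi _ =>
  ⟨i, _, _, fun _ hx => hx.1, Finset.empty_subset _, Nat.zero_le _, Route.up le_rfl hi⟩

/-- Peel off groups: the first consists of the chords that start before the smallest upper end,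
which therefore cross pairwise; repeat with the rest. Consecutive groups may interleave, but a group
lies to the right of the group two steps before it, so zigzags through alternate groups can be
concatenated. The numbers `n₁` and `n₂` count chords from the odd and the even groups; each zigzag
keeps half of its group. -/
theorem Route.exists_achieves_pair {m : ℕ} {F : Finset ℕ} {a : ℕ → ℕ}
    (ha : ∀ t ∈ F, a t < t) (hm : ∀ t ∈ F, t ≤ m) (A : Finset ℕ) (hAF : A ⊆ F)
    (hA : StrictMonoOn a A) :
    ∃ n₁ n₂, Route.Achieves m F a A n₁ ∧
      Route.Achieves m F a (A.filter fun t => ∃ u ∈ A, u ≤ a t) n₂ ∧ A.card ≤ 2 * (n₁ + n₂) := by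
  induction A using Finset.strongInduction with
  | H A ih =>
    rcases A.eq_empty_or_nonempty with rfl | hne
    · exact ⟨0, 0, Route.achieves_zero _, Route.achieves_zero _, by simp⟩
    obtain ⟨x, hx, hxmin⟩ : ∃ x ∈ A, ∀ t ∈ A, x ≤ t :=
      ⟨_, Finset.min'_mem _ hne, fun t ht => Finset.min'_le _ t ht⟩
    have hax := ha x (hAF hx)
    set B := A.filter fun t => ∃ u ∈ A, u ≤ a t with hB
    set C := A.filter fun t => ¬ ∃ u ∈ A, u ≤ a t with hC
    have hcard : B.card + C.card = A.card := Finset.card_filter_add_card_filter_not _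
    have hxC : x ∈ C := by
      simp only [hC, Finset.mem_filter, hx, true_and, not_exists, not_and, not_le]
      exact fun u hu => hax.trans_le (hxmin u hu)
    have hCA : C ⊆ A := Finset.filter_subset _ _
    have hBA : B ⊆ A := Finset.filter_subset _ _
    have hBss : B ⊂ A := by
      refine Finset.ssubset_iff_subset_ne.2 ⟨hBA, fun h => ?_⟩
      have := Finset.card_pos.2 ⟨x, hxC⟩
      rw [h] at hcard
      omega
    obtain ⟨n₁, n₂, h₁, h₂, hn⟩ := ih B hBss (hBA.trans hAF) (hA.mono (by exact_mod_cast hBA))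
    obtain ⟨y, hy, I, J, hI, hJ, hJc, hR⟩ := Route.exists_of_crossing hm x C (hCA.trans hAF)
      (hA.mono (by exact_mod_cast hCA))
      (fun t ht => by
        simp only [hC, Finset.mem_filter, not_exists, not_and, not_le] at ht
        exact ht.2 x hx)
      (fun t ht => hxmin t (hCA ht)) x hxC fun t ht => hxmin t (hCA ht)
    have hym := hm y (hAF (hCA hy))
    have hxy := hxmin y (hCA hy)
    have hBy : ∀ t ∈ B, y < t := by
      intro t ht
      simp only [hB, Finset.mem_filter] at ht
      obtain ⟨htA, u, hu, hut⟩ := ht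
      have hyC : a y < u := by
        have := hy
        simp only [hC, Finset.mem_filter, not_exists, not_and, not_le] at this
        exact this.2 u hu
      exact (hA.lt_iff_lt (hCA hy) htA).1 (by omega)
    -- The parities swap: the new group joins the route that skips the first group of `B`.
    refine ⟨J.card + n₂, n₁, fun i hi hiA => ?_, h₁, by omega⟩
    obtain ⟨j, I', J', hI', hJ', hn', hR'⟩ := h₂ y hym (by
      intro t ht
      simp only [Finset.mem_filter] at ht
      obtain ⟨-, u, hu, hut⟩ := ht
      exact (hBy u hu).le.trans hut)
    have hix := hiA x hx
    have hdis : Disjoint J J' := by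
      rw [Finset.disjoint_left]
      intro t ht ht'
      have h1 := hJ ht
      have h2 := (Finset.filter_subset _ _) (hJ' ht')
      simp only [hB, hC, Finset.mem_filter] at h1 h2
      exact h1.2 h2.2
    have h5 := (Route.up (a := a) (F := F) hix (by omega : a x ≤ m)).trans hR (by
      rintro z ⟨h3, h4⟩
      have := hI h4
      simp only [mem_Icc, mem_Ico, mem_union, mem_singleton_iff] at *
      omega) (by simp)
    have h6 := h5.trans hR' (by
      rintro z ⟨h3 | h3, h4⟩
      on_goal 2 => have := hI h3
      all_goals
        have := hI' h4
        simp only [mem_Icc, mem_Ico, mem_Ici, mem_union, mem_singleton_iff] at *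
        omega) (by simpa using hdis)
    refine ⟨_, _, _, ?_, ?_, ?_, h6⟩
    · rintro z ((h3 | h3) | h3)
      on_goal 2 => have := hI h3
      on_goal 3 => have := hI' h3
      all_goals
        simp only [mem_Icc, mem_Ico, mem_Ici, mem_union] at *
        omega
    · rw [Finset.empty_union]
      exact Finset.union_subset (hJ.trans hCA)
        (hJ'.trans ((Finset.filter_subset _ _).trans hBA))
    · rw [Finset.empty_union, Finset.card_union_of_disjoint hdis]
      omega

/-- Among chords with increasing lower ends, a quarter lie on a common route. -/
theorem Route.exists_of_strictMonoOn {m : ℕ} {F : Finset ℕ} {a : ℕ → ℕ}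
    (ha : ∀ t ∈ F, a t < t) (hm : ∀ t ∈ F, t ≤ m) (A : Finset ℕ) (hAF : A ⊆ F)
    (hA : StrictMonoOn a A) :
    ∃ i j I J, J ⊆ A ∧ A.card ≤ 4 * J.card ∧ Route m F a i j I J := by
  obtain ⟨n₁, n₂, h₁, h₂, hn⟩ := Route.exists_achieves_pair ha hm A hAF hA
  obtain ⟨j, I, J, -, hJ, hJc, hR⟩ := h₁ 0 (Nat.zero_le _) fun _ _ => Nat.zero_le _
  obtain ⟨j', I', J', -, hJ', hJc', hR'⟩ :=
    (h₂.mono (Finset.filter_subset _ _)) 0 (Nat.zero_le _) fun _ _ => Nat.zero_le _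
  rcases le_total n₁ n₂ with h | h
  · exact ⟨0, j', I', J', hJ', by omega, hR'⟩
  · exact ⟨0, j, I, J, hJ, by omega, hR⟩

/-- Erdős–Szekeres: more than `r * m` points contain an increasing set of more than `m` points or a
decreasing set of more than `r` points. -/
theorem exists_strictMonoOn_or_strictAntiOn {a : ℕ → ℕ} (m r : ℕ) (F : Finset ℕ)
    (hinj : InjOn a F) (hF : r * m < F.card) :
    (∃ A ⊆ F, StrictMonoOn a A ∧ m < A.card) ∨ ∃ A ⊆ F, StrictAntiOn a A ∧ r < A.card := by
  induction r generalizing F with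
  | zero =>
    obtain ⟨x, hx⟩ := Finset.card_pos.1 (by omega : 0 < F.card)
    exact Or.inr ⟨{x}, by simpa using hx, by simp [StrictAntiOn], by simp⟩
  | succ r ih =>
    -- `C` is the set of left-to-right records of `a`, on which `a` increases. If it is small,
    -- recurse on `B`, where every decreasing set can be lengthened by an earlier, larger value.
    set B := F.filter fun t => ∃ u ∈ F, u < t ∧ a t < a u with hB
    set C := F.filter fun t => ¬ ∃ u ∈ F, u < t ∧ a t < a u with hC
    have hcard : B.card + C.card = F.card := Finset.card_filter_add_card_filter_not _
    have hBF : B ⊆ F := Finset.filter_subset _ _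
    by_cases hCm : m < C.card
    · refine Or.inl ⟨C, Finset.filter_subset _ _, fun x hx y hy hxy => ?_, hCm⟩
      simp only [hC, Finset.coe_filter, mem_ofPred_eq, not_exists, not_and, not_lt] at hx hy
      exact lt_of_le_of_ne (hy.2 x hx.1 hxy) fun h => hxy.ne (hinj hx.1 hy.1 h)
    · rcases ih B (hinj.mono (by exact_mod_cast hBF)) (by rw [add_mul] at hF; omega) with
        ⟨A, hA, h⟩ | ⟨A, hA, hanti, hr⟩
      · exact Or.inl ⟨A, hA.trans hBF, h⟩
      · obtain ⟨x, hx, hxmin⟩ : ∃ x ∈ A, ∀ t ∈ A, x ≤ t :=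
          ⟨_, Finset.min'_mem _ (Finset.card_pos.1 (by omega)), fun t ht => Finset.min'_le _ t ht⟩
        have hxB := hA hx
        simp only [hB, Finset.mem_filter] at hxB
        obtain ⟨hxF, u, huF, hux, hau⟩ := hxB
        have huA : u ∉ A := fun h => by have := hxmin u h; omega
        refine Or.inr ⟨insert u A, Finset.insert_subset huF (hA.trans hBF), ?_, ?_⟩
        · have hlow : ∀ t ∈ A, a t < a u := fun t ht =>
            lt_of_le_of_lt (hanti.antitoneOn hx ht (hxmin t ht)) hau
          intro s hs t ht hst
          simp only [Finset.coe_insert, Set.mem_insert_iff, Finset.mem_coe] at hs ht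
          rcases hs with rfl | hs <;> rcases ht with rfl | ht
          · omega
          · exact hlow t ht
          · have := hxmin s hs
            omega
          · exact hanti hs ht hst
        · rw [Finset.card_insert_of_notMem huA]
          omega

/-- More than `4 (k - 1)²` chords with distinct lower ends admit a route using `k` of them. -/
theorem Route.exists_of_card {m k : ℕ} {F : Finset ℕ} {a : ℕ → ℕ}
    (ha : ∀ t ∈ F, a t < t) (hm : ∀ t ∈ F, t ≤ m) (hinj : InjOn a F) (hk : 1 ≤ k)
    (hF : (k - 1) * (4 * (k - 1)) < F.card) :
    ∃ i j I J, J ⊆ F ∧ k ≤ J.card ∧ Route m F a i j I J := by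
  rcases exists_strictMonoOn_or_strictAntiOn _ _ F hinj hF with ⟨A, hAF, hA, hc⟩ | ⟨A, hAF, hA, hc⟩
  · obtain ⟨i, j, I, J, hJ, hJc, hR⟩ := Route.exists_of_strictMonoOn ha hm A hAF hA
    exact ⟨i, j, I, J, hJ.trans hAF, by omega, hR⟩
  · obtain ⟨x, hx, hxmax⟩ : ∃ x ∈ A, ∀ t ∈ A, t ≤ x :=
      ⟨_, Finset.max'_mem _ (Finset.card_pos.1 (by omega)), fun t ht => Finset.le_max' _ t ht⟩
    obtain ⟨⟨j, I, -, hR⟩, -⟩ := Route.exists_of_strictAntiOn ha hm A hAF hA x hx hxmax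
    exact ⟨_, _, _, _, hAF, by omega, hR⟩

/-! ### Surgery on paths -/

namespace SimpleGraph

theorem Walk.IsPath.append_of_inter {V : Type*} {G : SimpleGraph V} {u v w : V} {p : G.Walk u v}
    {q : G.Walk v w} (hp : p.IsPath) (hq : q.IsPath)
    (h : ∀ x ∈ p.support, x ∈ q.support → x = v) : (p.append q).IsPath := by
  rw [Walk.isPath_def, Walk.support_append, List.nodup_append']
  have hq' := hq.support_nodup
  rw [← Walk.cons_tail_support, List.nodup_cons] at hq'
  refine ⟨hp.support_nodup, hq'.2, fun x hx hx' => ?_⟩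
  obtain rfl := h x hx (List.mem_of_mem_tail hx')
  exact hq'.1 hx'

/-- Replacing a segment of a path, between two of its vertices, by a path that is otherwise disjoint from it. -/
theorem Walk.IsPath.exists_detour {V : Type*} {G : SimpleGraph V} {x y w z : V}
    {p : G.Walk x y} (hp : p.IsPath) (hw : w ∈ p.support) (hz : z ∈ p.support) {r : G.Walk w z}
    (hr : r.IsPath) (h : ∀ s ∈ p.support, s ∈ r.support → s = w ∨ s = z) :
    ∃ p' : G.Walk x y, p'.IsPath ∧ (∀ s ∈ p'.support, s ∈ p.support ∨ s ∈ r.support) ∧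
      ∀ e ∈ r.edges, e ∈ p'.edges := by
  classical
  obtain ⟨p₁, p₂, rfl⟩ := Walk.mem_support_iff_exists_append.1 hw
  have h12 : ∀ s ∈ p₁.support, s ∈ p₂.support → s = w := fun s h1 h2 => by
    by_contra hne
    exact hp.ne_of_mem_support_of_append hne h1 h2 rfl
  have hp₁ := hp.of_append_left
  have hp₂ := hp.of_append_right
  simp only [Walk.mem_support_append_iff] at hz h ⊢
  -- Either `z` precedes `w` on the path, and `r` is inserted backwards, or it follows `w`.
  rcases hz with hz | hz
  · obtain ⟨p₃, p₄, rfl⟩ := Walk.mem_support_iff_exists_append.1 hz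
    have h34 : ∀ s ∈ p₃.support, s ∈ p₄.support → s = z := fun s h1 h2 => by
      by_contra hne
      exact hp₁.ne_of_mem_support_of_append hne h1 h2 rfl
    have hwz : w ∈ p₃.support → w = z := fun h => h34 w h p₄.end_mem_support
    simp only [Walk.mem_support_append_iff] at h h12 ⊢
    refine ⟨(p₃.append r.reverse).append p₂, ?_, ?_, ?_⟩
    · refine (Walk.IsPath.append_of_inter hp₁.of_append_left hr.reverse ?_).append_of_inter hp₂ ?_
      · intro s hs hs'
        rw [Walk.support_reverse, List.mem_reverse] at hs'
        rcases h s (Or.inl (Or.inl hs)) hs' with rfl | rfl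
        · exact hwz hs
        · rfl
      · intro s hs hs'
        rw [Walk.mem_support_append_iff, Walk.support_reverse, List.mem_reverse] at hs
        rcases hs with hs | hs
        · exact h12 s (Or.inl hs) hs'
        · rcases h s (Or.inr hs') hs with rfl | rfl
          · rfl
          · exact h12 _ (Or.inl p₃.end_mem_support) hs'
    · intro s hs
      simp only [Walk.mem_support_append_iff, Walk.support_reverse, List.mem_reverse] at hs
      tauto
    · intro e he
      simp [Walk.edges_append, he]
  · obtain ⟨p₃, p₄, rfl⟩ := Walk.mem_support_iff_exists_append.1 hz
    have h34 : ∀ s ∈ p₃.support, s ∈ p₄.support → s = z := fun s h1 h2 => by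
      by_contra hne
      exact hp₂.ne_of_mem_support_of_append hne h1 h2 rfl
    have hwz : w ∈ p₄.support → w = z := fun h => h34 w p₃.start_mem_support h
    simp only [Walk.mem_support_append_iff] at h h12 ⊢
    refine ⟨(p₁.append r).append p₄, ?_, ?_, ?_⟩
    · refine (Walk.IsPath.append_of_inter hp₁ hr ?_).append_of_inter hp₂.of_append_right ?_
      · intro s hs hs'
        rcases h s (Or.inl hs) hs' with rfl | rfl
        · rfl
        · exact h12 s hs (Or.inl p₃.end_mem_support)
      · intro s hs hs'
        rw [Walk.mem_support_append_iff] at hs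
        rcases hs with hs | hs
        · obtain rfl := h12 s hs (Or.inr hs')
          exact hwz hs'
        · rcases h s (Or.inr (Or.inr hs')) hs with rfl | rfl
          · exact hwz hs'
          · rfl
    · intro s hs
      simp only [Walk.mem_support_append_iff] at hs
      tauto
    · intro e he
      simp [Walk.edges_append, he]

/-- A walk that starts in `T` and can leave `T` only into `B` contains a path inside `T` to its first vertex in `B`. -/
theorem Walk.exists_isPath_first {V : Type*} {G : SimpleGraph V} {u v : V} (p : G.Walk u v)
    (T B : Set V) (hu : u ∈ T ∨ u ∈ B) (hv : v ∈ B)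
    (hT : ∀ s ∈ T, ∀ t ∈ p.support, G.Adj s t → t ∈ T ∨ t ∈ B) :
    ∃ z ∈ B, ∃ q : G.Walk u z, q.IsPath ∧ (∀ s ∈ q.support, s ∈ p.support) ∧
      ∀ s ∈ q.support, s = z ∨ s ∈ T ∧ s ∉ B := by
  classical
  suffices h : ∃ z ∈ B, ∃ q : G.Walk u z, (∀ s ∈ q.support, s ∈ p.support) ∧
      ∀ s ∈ q.support, s = z ∨ s ∈ T ∧ s ∉ B by
    obtain ⟨z, hz, q, h1, h2⟩ := h
    exact ⟨z, hz, q.bypass, q.bypass_isPath, fun s hs => h1 s (q.support_bypass_subset_support hs),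
      fun s hs => h2 s (q.support_bypass_subset_support hs)⟩
  induction p with
  | nil => exact ⟨_, hv, Walk.nil, by simp, by simp⟩
  | @cons u w v h p ih =>
    simp only [Walk.support_cons, List.mem_cons, forall_eq_or_imp] at hT
    by_cases huB : u ∈ B
    · exact ⟨u, huB, Walk.nil, by simp, by simp⟩
    · have huT := hu.resolve_right huB
      obtain ⟨z, hz, q, h1, h2⟩ :=
        ih ((hT u huT).2 w p.start_mem_support h) hv fun s hs => (hT s hs).2
      refine ⟨z, hz, q.cons h, ?_, ?_⟩
      · intro s hs
        rw [Walk.support_cons, List.mem_cons] at hs ⊢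
        exact hs.imp_right (h1 s)
      · intro s hs
        rw [Walk.support_cons, List.mem_cons] at hs
        rcases hs with rfl | hs
        · exact Or.inr ⟨huT, huB⟩
        · exact h2 s hs

/-! ### Components of induced subgraphs -/

/-- The vertices that can be reached from `v` inside `D`. -/
def reachIn {V : Type*} (G : SimpleGraph V) (D : Set V) (v : V) : Set V :=
  {z | ∃ p : G.Walk v z, ∀ s ∈ p.support, s ∈ D}

theorem mem_reachIn_self {V : Type*} {G : SimpleGraph V} {D : Set V} {v : V} (hv : v ∈ D) :
    v ∈ G.reachIn D v := ⟨Walk.nil, by simpa using hv⟩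

theorem reachIn_subset {V : Type*} {G : SimpleGraph V} {D : Set V} {v : V} :
    G.reachIn D v ⊆ D := fun _ ⟨p, hp⟩ => hp _ p.end_mem_support

theorem reachIn_of_adj {V : Type*} {G : SimpleGraph V} {D : Set V} {v w z : V}
    (hw : w ∈ G.reachIn D v) (h : G.Adj w z) (hz : z ∈ D) : z ∈ G.reachIn D v := by
  obtain ⟨p, hp⟩ := hw
  refine ⟨p.concat h, fun s hs => ?_⟩
  rw [Walk.support_concat, List.mem_append, List.mem_singleton] at hs
  rcases hs with hs | rfl
  · exact hp s hs
  · exact hz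

theorem reachIn_trans {V : Type*} {G : SimpleGraph V} {D : Set V} {v w z : V}
    (hw : w ∈ G.reachIn D v) (hz : z ∈ G.reachIn D w) : z ∈ G.reachIn D v := by
  obtain ⟨p, hp⟩ := hw
  obtain ⟨q, hq⟩ := hz
  refine ⟨p.append q, fun s hs => ?_⟩
  rw [Walk.mem_support_append_iff] at hs
  exact hs.elim (hp s) (hq s)

theorem reachIn_symm {V : Type*} {G : SimpleGraph V} {D : Set V} {v w : V}
    (hw : w ∈ G.reachIn D v) : v ∈ G.reachIn D w := by
  obtain ⟨p, hp⟩ := hw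
  exact ⟨p.reverse, fun s hs => hp s (by simpa using hs)⟩

theorem reachIn_mono {V : Type*} {G : SimpleGraph V} {D E : Set V} (h : D ⊆ E) (v : V) :
    G.reachIn D v ⊆ G.reachIn E v := fun _ ⟨p, hp⟩ => ⟨p, fun s hs => h (hp s hs)⟩

theorem IsTwoConnected.mem_reachIn {V : Type*} [Fintype V] {G : SimpleGraph V}
    (hG : G.IsTwoConnected) {v x y : V} (hx : x ≠ v) (hy : y ≠ v) : y ∈ G.reachIn {v}ᶜ x := by
  obtain ⟨p⟩ := (hG.2.2 v).preconnected ⟨x, hx⟩ ⟨y, hy⟩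
  refine ⟨p.map (Embedding.induce {w | w ≠ v}).toHom, fun s hs => ?_⟩
  replace hs := (Walk.support_map (Embedding.induce {w | w ≠ v}).toHom p) ▸ hs
  rw [List.mem_map] at hs
  obtain ⟨t, -, rfl⟩ := hs
  exact t.2

/-! ### Ears in 2-connected graphs -/

/-- An ear from `x` to the set `A` with interior in `T`. -/
structure IsEar {V : Type*} {G : SimpleGraph V} (T A : Set V) {x a : V} (p : G.Walk x a) : Prop where
  isPath : p.IsPath
  mem : a ∈ A
  support : ∀ z ∈ p.support, z = x ∨ z = a ∨ z ∈ T

section Ear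

variable {V : Type*} [Fintype V] {G : SimpleGraph V} {T A : Set V} {x y : V}

/-- Since `G - x` is connected, walk from `y` to `A` while avoiding `x`, stop at the first vertex of
`A`, and put the edge `xy` in front. -/
theorem IsTwoConnected.exists_isEar_first (hG : G.IsTwoConnected) (hxT : x ∉ T) (hxA : x ∉ A)
    (hA : A.Nonempty) (hN : ∀ z ∈ T, ∀ w, G.Adj z w → w ∈ T ∨ w = x ∨ w ∈ A)
    (hy : y ∈ T) (hxy : G.Adj x y) :
    ∃ (a : V) (p : G.Walk x a), IsEar T A p ∧ s(x, y) ∈ p.edges := by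
  obtain ⟨b, hb⟩ := hA
  obtain ⟨p, hp⟩ := hG.mem_reachIn (v := x) (x := y) (y := b) hxy.ne' (by rintro rfl; exact hxA hb)
  obtain ⟨a, ha, q, hq, hqp, hqT⟩ := p.exists_isPath_first T A (Or.inl hy) hb
    fun s hs t ht hst => (hN s hs t hst).imp_right fun h => h.resolve_left (hp t ht)
  refine ⟨a, q.cons hxy, ⟨hq.cons fun h => hp x (hqp x h) rfl, ha, ?_⟩, by simp⟩
  intro z hz
  rw [Walk.support_cons, List.mem_cons] at hz
  exact hz.imp_right fun hz => (hqT z hz).imp_right And.left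

/-- Since `G - w` is connected, walk from `w'` towards `x` avoiding `w`, until the old ear or `A` is
first met at some `z`. If `z` is on the old ear, reroute the ear between `w` and `z`; otherwise
follow it only up to `w` and leave along the new path. -/
theorem IsTwoConnected.exists_isEar_step (hG : G.IsTwoConnected) (hxT : x ∉ T)
    (hTA : Disjoint T A) (hN : ∀ z ∈ T, ∀ w, G.Adj z w → w ∈ T ∨ w = x ∨ w ∈ A)
    {a w w' : V} {p : G.Walk x a} (hp : IsEar T A p) (hw : w ∈ p.support) (hwT : w ∈ T)
    (hw' : w' ∈ T) (hww : G.Adj w w') :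
    ∃ (a : V) (p : G.Walk x a), IsEar T A p ∧ s(w, w') ∈ p.edges := by
  classical
  obtain ⟨R, hR⟩ := hG.mem_reachIn (v := w) (x := w') (y := x) hww.ne'
    (by rintro rfl; exact hxT hwT)
  obtain ⟨z, hz, q, hq, hqR, hqB⟩ := R.exists_isPath_first T ({s | s ∈ p.support} ∪ A)
    (Or.inl hw') (Or.inl p.start_mem_support) fun s hs t ht hst => by
      rcases hN s hs t hst with h | rfl | h
      · exact Or.inl h
      · exact Or.inr (Or.inl p.start_mem_support)
      · exact Or.inr (Or.inr h)
  have hwq : w ∉ q.support := fun h => hR w (hqR w h) rfl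
  have hr : (q.cons hww).IsPath := hq.cons hwq
  have hrT : ∀ s ∈ (q.cons hww).support, s = z ∨ s ∈ T := by
    intro s hs
    rw [Walk.support_cons, List.mem_cons] at hs
    rcases hs with rfl | hs
    · exact Or.inr hwT
    · exact (hqB s hs).imp_right And.left
  have hrp : ∀ s ∈ p.support, s ∈ (q.cons hww).support → s = w ∨ s = z := by
    intro s hs hs'
    rw [Walk.support_cons, List.mem_cons] at hs'
    exact hs'.imp_right fun h => (hqB s h).resolve_right fun h => h.2 (Or.inl hs)
  by_cases hzp : z ∈ p.support
  · obtain ⟨p', hp', hps, hpe⟩ := hp.isPath.exists_detour hw hzp hr hrp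
    refine ⟨a, p', ⟨hp', hp.mem, fun s hs => ?_⟩, hpe _ (by simp)⟩
    rcases hps s hs with h | h
    · exact hp.support s h
    · rcases hrT s h with rfl | h
      · exact hp.support _ hzp
      · exact Or.inr (Or.inr h)
  · have hzA : z ∈ A := hz.resolve_left hzp
    refine ⟨z, (p.takeUntil w hw).append (q.cons hww), ⟨?_, hzA, fun s hs => ?_⟩, by simp⟩
    · refine (hp.isPath.takeUntil hw).append_of_inter hr fun s hs hs' => ?_
      have hsp := p.support_takeUntil_subset_support hw hs
      exact (hrp s hsp hs').resolve_right fun h => hzp (h ▸ hsp)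
    · rw [Walk.mem_support_append_iff] at hs
      rcases hs with hs | hs
      · rcases hp.support s (p.support_takeUntil_subset_support hw hs) with h | rfl | h
        · exact Or.inl h
        · have : w ∈ A → False := fun h => hTA.le_bot ⟨hwT, h⟩
          have hne : s ≠ w := fun h => this (h ▸ hp.mem)
          exact (Walk.endpoint_notMem_support_takeUntil hp.isPath hw hne hs).elim
        · exact Or.inr (Or.inr h)
      · exact Or.inr (hrT s hs)

/-- In a 2-connected graph, an edge inside a connected part `T` attached to `x` and `A` lies on an ear. -/
theorem IsTwoConnected.exists_isEar (hG : G.IsTwoConnected) {D : Set V} (hxA : x ∉ A)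
    (hA : A.Nonempty) (hD : ∀ w, w ∈ D ∨ w = x ∨ w ∈ A) (hxD : x ∉ D) (hAD : Disjoint D A)
    (hy : y ∈ D) (hxy : G.Adj x y) {e : Sym2 V} (he : e ∈ G.edgeSet)
    (heT : e = s(x, y) ∨ ∀ w ∈ e, w ∈ G.reachIn D y) :
    ∃ (a : V) (p : G.Walk x a), IsEar (G.reachIn D y) A p ∧ e ∈ p.edges := by
  have hN : ∀ z ∈ G.reachIn D y, ∀ w, G.Adj z w → w ∈ G.reachIn D y ∨ w = x ∨ w ∈ A :=
    fun z hz w hzw => (hD w).imp_left (reachIn_of_adj hz hzw)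
  have hxT : x ∉ G.reachIn D y := fun h => hxD (reachIn_subset h)
  have hTA : Disjoint (G.reachIn D y) A := hAD.mono_left reachIn_subset
  obtain ⟨a₀, p₀, hp₀, he₀⟩ := hG.exists_isEar_first hxT hxA hA hN (mem_reachIn_self hy) hxy
  rcases heT with rfl | heT
  · exact ⟨a₀, p₀, hp₀, he₀⟩
  -- Push the ear along a walk inside the component, one edge at a time, until it meets an end of
  -- `e`.
  have key : ∀ (u w : V) (q : G.Walk u w), (∀ s ∈ q.support, s ∈ D) → u ∈ G.reachIn D y →
      (∃ (a : V) (p : G.Walk x a), IsEar (G.reachIn D y) A p ∧ u ∈ p.support) →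
      ∃ (a : V) (p : G.Walk x a), IsEar (G.reachIn D y) A p ∧ w ∈ p.support := by
    intro u w q
    induction q with
    | nil => exact fun _ _ h => h
    | @cons u t w h q ih =>
      rintro hq hu ⟨a, p, hp, hup⟩
      simp only [Walk.support_cons, List.mem_cons, forall_eq_or_imp] at hq
      have ht := reachIn_of_adj hu h (hq.2 t q.start_mem_support)
      obtain ⟨a', p', hp', he'⟩ := hG.exists_isEar_step hxT hTA hN hp hup hu ht h
      exact ih hq.2 ht ⟨a', p', hp', p'.snd_mem_support_of_mem_edges he'⟩
  induction e with
  | h w w' =>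
    have hwT := heT w (by simp)
    obtain ⟨q, hq⟩ := hwT
    obtain ⟨a, p, hp, hwp⟩ := key y w q hq (mem_reachIn_self hy)
      ⟨a₀, p₀, hp₀, p₀.snd_mem_support_of_mem_edges he₀⟩
    exact hG.exists_isEar_step hxT hTA hN hp hwp (heT w (by simp)) (heT w' (by simp)) he

end Ear

/-- The last vertex of an ear has a neighbour in the interior, as soon as the interior is met. -/
theorem IsEar.exists_adj_end {V : Type*} {G : SimpleGraph V} {T A : Set V} {x a : V}
    {p : G.Walk x a} (hp : IsEar T A p) (hTA : Disjoint T A) (hxT : x ∉ T) {w : V}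
    (hw : w ∈ p.support) (hwT : w ∈ T) : ∃ z ∈ T, G.Adj z a := by
  have hwa : w ≠ a := by
    rintro rfl
    exact hTA.le_bot ⟨hwT, hp.mem⟩
  have hwx : w ≠ x := by
    rintro rfl
    exact hxT hwT
  obtain ⟨p₁, p₂, rfl⟩ := Walk.mem_support_iff_exists_append.1 hw
  have hn : ¬ p₂.Nil := fun h => hwa h.eq
  have hadj := p₂.adj_penultimate hn
  refine ⟨_, ?_, hadj⟩
  have hmem : p₂.penultimate ∈ p₂.support := p₂.getVert_mem_support _
  rcases hp.support p₂.penultimate (by simp [hmem]) with h | h | h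
  · by_contra
    refine hp.isPath.ne_of_mem_support_of_append (x := x) (y := x) hwx.symm
      p₁.start_mem_support ?_ rfl
    rw [← h]
    exact hmem
  · exact (hadj.ne h).elim
  · exact h

end SimpleGraph

/-! ### Paths with chords, and the degree bound -/

theorem Route.subset {m : ℕ} {F : Finset ℕ} {a : ℕ → ℕ} (ha : ∀ t ∈ F, a t < t)
    (hm : ∀ t ∈ F, t ≤ m) {i j : ℕ} {I : Set ℕ} {J : Finset ℕ} (h : Route m F a i j I J) :
    I ⊆ Iic m ∧ J ⊆ F := by
  induction h with
  | up hij hj => exact ⟨fun _ h => h.2.trans hj, Finset.empty_subset _⟩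
  | chord ht =>
    refine ⟨?_, by simpa using ht⟩
    rintro z (rfl | rfl)
    · exact (ha _ ht).le.trans (hm _ ht)
    · exact hm _ ht
  | symm _ ih => exact ih
  | trans _ _ _ _ ih ih' => exact ⟨union_subset ih.1 ih'.1, Finset.union_subset ih.2 ih'.2⟩

namespace SimpleGraph

theorem exists_isPath_of_adj_succ {V : Type*} {G : SimpleGraph V} {v : ℕ → V} {m : ℕ}
    (hinj : InjOn v (Iic m)) (hadj : ∀ i < m, G.Adj (v i) (v (i + 1))) {i j : ℕ} (hij : i ≤ j)
    (hj : j ≤ m) :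
    ∃ p : G.Walk (v i) (v j), p.IsPath ∧ (∀ s ∈ p.support, ∃ l ∈ Icc i j, s = v l) ∧
      ∀ l ∈ Ico i j, s(v l, v (l + 1)) ∈ p.edges := by
  induction j, hij using Nat.le_induction with
  | base => exact ⟨Walk.nil, by simp, by simp, by simp⟩
  | succ j hij ih =>
    obtain ⟨p, hp, hps, hpe⟩ := ih (by omega)
    refine ⟨p.concat (hadj j (by omega)), hp.concat (fun h => ?_) _, ?_, ?_⟩
    · obtain ⟨l, hl, hlj⟩ := hps _ h
      have := hinj (mem_Iic.2 hj) (mem_Iic.2 (by have := hl.2; omega)) hlj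
      have := hl.2
      omega
    · intro s hs
      rw [Walk.support_concat, List.mem_append, List.mem_singleton] at hs
      rcases hs with hs | rfl
      · obtain ⟨l, hl, rfl⟩ := hps s hs
        exact ⟨l, ⟨hl.1, hl.2.trans (Nat.le_succ j)⟩, rfl⟩
      · exact ⟨j + 1, ⟨by omega, le_rfl⟩, rfl⟩
    · intro l hl
      rw [Walk.edges_concat, List.concat_eq_append, List.mem_append, List.mem_singleton]
      rcases Nat.lt_succ_iff_lt_or_eq.1 hl.2 with h | rfl
      · exact Or.inl (hpe l ⟨hl.1, h⟩)
      · exact Or.inr rfl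

/-- A path `v 0, …, v m` with chords: for `t ∈ F` there is an ear from `v t` to `v (a t)` through the edge `e t`,
with interior in `K t`; the interiors are disjoint from the path and from each other. -/
structure IsChordedPath {V : Type*} (G : SimpleGraph V) (v : ℕ → V) (m : ℕ) (F : Finset ℕ)
    (a : ℕ → ℕ) (K : ℕ → Set V) (e : ℕ → Sym2 V) : Prop where
  injOn : InjOn v (Iic m)
  adj : ∀ i < m, G.Adj (v i) (v (i + 1))
  lt : ∀ t ∈ F, a t < t
  le : ∀ t ∈ F, t < m
  notMem : ∀ t ∈ F, ∀ i ≤ m, v i ∉ K t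
  disjoint : ∀ t ∈ F, ∀ u ∈ F, t ≠ u → Disjoint (K t) (K u)
  ear : ∀ t ∈ F, ∃ p : G.Walk (v t) (v (a t)), p.IsPath ∧
    (∀ s ∈ p.support, s = v t ∨ s = v (a t) ∨ s ∈ K t) ∧ e t ∈ p.edges
  adj_top : ∀ t ∈ F, ∃ s ∈ K t, G.Adj (v t) s
  adj_bot : ∀ t ∈ F, ∃ s ∈ K t, G.Adj (v (a t)) s
  meets : ∀ t ∈ F, ∃ s ∈ K t, s ∈ e t

section Chorded

variable {V : Type*} {G : SimpleGraph V} {v : ℕ → V} {m : ℕ} {F : Finset ℕ}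
  {a : ℕ → ℕ} {K : ℕ → Set V} {e : ℕ → Sym2 V}

theorem IsChordedPath.mono (h : G.IsChordedPath v m F a K e) {F' : Finset ℕ} (hF : F' ⊆ F) :
    G.IsChordedPath v m F' a K e where
  injOn := h.injOn
  adj := h.adj
  lt t ht := h.lt t (hF ht)
  le t ht := h.le t (hF ht)
  notMem t ht := h.notMem t (hF ht)
  disjoint t ht u hu := h.disjoint t (hF ht) u (hF hu)
  ear t ht := h.ear t (hF ht)
  adj_top t ht := h.adj_top t (hF ht)
  adj_bot t ht := h.adj_bot t (hF ht)
  meets t ht := h.meets t (hF ht)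

/-- Ear interiors avoid the path and each other, so two pieces with disjoint chord sets can meet
only in path vertices indexed by `I ∩ I'`, that is, at their junction. -/
theorem IsChordedPath.exists_isPath (h : G.IsChordedPath v m F a K e) {i j : ℕ} {I : Set ℕ}
    {J : Finset ℕ} (hR : Route m F a i j I J) :
    ∃ p : G.Walk (v i) (v j), p.IsPath ∧
      (∀ s ∈ p.support, (∃ l ∈ I, s = v l) ∨ ∃ t ∈ J, s ∈ K t) ∧ ∀ t ∈ J, e t ∈ p.edges := by
  have hm : ∀ t ∈ F, t ≤ m := fun t ht => (h.le t ht).le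
  induction hR with
  | up hij hj =>
    obtain ⟨p, hp, hps, -⟩ := exists_isPath_of_adj_succ h.injOn h.adj hij hj
    exact ⟨p, hp, fun s hs => Or.inl (hps s hs), by simp⟩
  | @chord t ht =>
    obtain ⟨p, hp, hps, hpe⟩ := h.ear t ht
    refine ⟨p.reverse, hp.reverse, fun s hs => ?_, by simpa using hpe⟩
    rcases hps s (by simpa using hs) with rfl | rfl | hs
    · exact Or.inl ⟨t, by simp, rfl⟩
    · exact Or.inl ⟨a t, by simp, rfl⟩
    · exact Or.inr ⟨t, by simp, hs⟩
  | symm _ ih =>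
    obtain ⟨p, hp, hps, hpe⟩ := ih
    exact ⟨p.reverse, hp.reverse, fun s hs => hps s (by simpa using hs), by simpa using hpe⟩
  | trans hR hR' hI hJ ih ih' =>
    obtain ⟨p, hp, hps, hpe⟩ := ih
    obtain ⟨p', hp', hps', hpe'⟩ := ih'
    obtain ⟨hIm, hJF⟩ := hR.subset h.lt hm
    obtain ⟨hIm', hJF'⟩ := hR'.subset h.lt hm
    refine ⟨p.append p', hp.append_of_inter hp' fun s hs hs' => ?_, fun s hs => ?_, fun t ht => ?_⟩
    · rcases hps s hs with ⟨l, hl, rfl⟩ | ⟨t, ht, hst⟩ <;>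
        rcases hps' _ hs' with ⟨l', hl', hll⟩ | ⟨t', ht', hst'⟩
      · have := h.injOn (hIm hl) (hIm' hl') hll
        subst this
        rw [mem_singleton_iff.1 (hI ⟨hl, hl'⟩)]
      · exact (h.notMem t' (hJF' ht') l (hIm hl) hst').elim
      · exact (h.notMem t (hJF ht) l' (hIm' hl') (hll ▸ hst)).elim
      · by_cases htt : t = t'
        · subst htt
          exact (Finset.disjoint_left.1 hJ ht ht').elim
        · exact ((h.disjoint t (hJF ht) t' (hJF' ht') htt).le_bot ⟨hst, hst'⟩).elim
    · rw [Walk.mem_support_append_iff] at hs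
      rcases hs with hs | hs
      · rcases hps s hs with ⟨l, hl, hs⟩ | ⟨t, ht, hs⟩
        · exact Or.inl ⟨l, Or.inl hl, hs⟩
        · exact Or.inr ⟨t, Finset.mem_union_left _ ht, hs⟩
      · rcases hps' s hs with ⟨l, hl, hs⟩ | ⟨t, ht, hs⟩
        · exact Or.inl ⟨l, Or.inr hl, hs⟩
        · exact Or.inr ⟨t, Finset.mem_union_right _ ht, hs⟩
    · rw [Walk.edges_append, List.mem_append]
      exact (Finset.mem_union.1 ht).imp (hpe t) (hpe' t)

/-- The edge `e t` has an end in `K t`, and the ear of any other chord avoids `K t`. Hence counting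
chords counts marked edges. -/
theorem IsChordedPath.injOn_edge (h : G.IsChordedPath v m F a K e) : InjOn e F := by
  intro t ht u hu htu
  by_contra hne
  obtain ⟨s, hs, hse⟩ := h.meets t ht
  obtain ⟨p, hp, hps, hpe⟩ := h.ear u hu
  rw [htu] at hse
  rcases hps s (p.mem_support_of_mem_edges hpe hse) with rfl | rfl | hsu
  · exact h.notMem t ht u (h.le u hu).le hs
  · exact h.notMem t ht (a u) ((h.lt u hu).trans (h.le u hu)).le hs
  · exact (h.disjoint t ht u hu hne).le_bot ⟨hs, hsu⟩

variable [Fintype V] [DecidableRel G.Adj]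

/-- At an inner vertex of the path there is room for one chord only. -/
theorem IsChordedPath.eq_of_adj (h : G.IsChordedPath v m F a K e) (h3 : G.IsSubcubic)
    {i t u : ℕ} (hi : 0 < i) (him : i < m) (ht : t ∈ F) (hu : u ∈ F)
    (hti : ∃ s ∈ K t, G.Adj (v i) s) (hui : ∃ s ∈ K u, G.Adj (v i) s) : t = u := by
  classical
  by_contra hne
  obtain ⟨s, hs, his⟩ := hti
  obtain ⟨s', hs', his'⟩ := hui
  obtain ⟨l, rfl⟩ : ∃ l, i = l + 1 := ⟨i - 1, by omega⟩
  have h1 := h.adj l (by omega)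
  have h2 := h.adj (l + 1) him
  have hne1 : v l ≠ v (l + 1 + 1) := fun hv => by
    have := h.injOn (mem_Iic.2 (by omega)) (mem_Iic.2 (by omega)) hv
    omega
  have hK : ∀ t ∈ F, ∀ s ∈ K t, ∀ l ≤ m, v l ≠ s := fun t ht s hs l hl hv =>
    h.notMem t ht l hl (hv ▸ hs)
  have hss : s ≠ s' := by
    rintro rfl
    exact (h.disjoint t ht u hu hne).le_bot ⟨hs, hs'⟩
  -- Two path neighbours and one neighbour in each of two disjoint interiors would make degree four.
  have hsub : ({v l, v (l + 1 + 1), s, s'} : Finset V) ⊆ G.neighborFinset (v (l + 1)) := by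
    intro z hz
    simp only [Finset.mem_insert, Finset.mem_singleton] at hz
    rw [mem_neighborFinset]
    rcases hz with rfl | rfl | rfl | rfl
    · exact h1.symm
    · exact h2
    · exact his
    · exact his'
  have hc := Finset.card_le_card hsub
  rw [card_neighborFinset_eq_degree, Finset.card_insert_of_notMem, Finset.card_insert_of_notMem,
    Finset.card_insert_of_notMem, Finset.card_singleton] at hc
  · have := h3 (v (l + 1))
    omega
  · simpa using hss
  · simp [hK t ht s hs _ (by omega : l + 1 + 1 ≤ m), hK u hu s' hs' _ (by omega : l + 1 + 1 ≤ m)]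
  · simp [hne1, hK t ht s hs l (by omega), hK u hu s' hs' l (by omega)]

/-- At most two chords end at the first vertex of the path. -/
theorem IsChordedPath.card_filter_eq_zero_le (h : G.IsChordedPath v m F a K e)
    (h3 : G.IsSubcubic) : (F.filter fun t => a t = 0).card ≤ 2 := by
  classical
  rcases F.eq_empty_or_nonempty with rfl | ⟨t₀, ht₀⟩
  · simp
  have hm : 0 < m := (Nat.zero_le _).trans_lt (h.le t₀ ht₀)
  have : Nonempty V := ⟨v 0⟩
  choose! g hg hga using h.adj_bot
  -- Chords at `v 0` enter it from distinct neighbours, none of which is `v 1`.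
  have hcard := Finset.card_le_card_of_injOn (s := F.filter fun t => a t = 0)
    (t := (G.neighborFinset (v 0)).erase (v 1)) g (by
      intro t ht
      simp only [Finset.coe_filter, mem_ofPred_eq] at ht
      have := hga t ht.1
      rw [ht.2] at this
      simp only [Finset.coe_erase, coe_neighborFinset, mem_sdiff, mem_neighborSet,
        mem_singleton_iff]
      refine ⟨this, fun hv => h.notMem t ht.1 1 hm ?_⟩
      rw [← hv]
      exact hg t ht.1) (by
      intro t ht u hu htu
      simp only [Finset.coe_filter, mem_ofPred_eq] at ht hu
      by_contra hne
      exact (h.disjoint t ht.1 u hu.1 hne).le_bot ⟨hg t ht.1, htu ▸ hg u hu.1⟩)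
  rw [Finset.card_erase_of_mem (by simpa using h.adj 0 hm), card_neighborFinset_eq_degree] at hcard
  have := h3 (v 0)
  omega

/-- A path with many chords in a subcubic graph yields a path through `k` of the marked edges. -/
theorem IsChordedPath.exists_isPath_of_card (h : G.IsChordedPath v m F a K e)
    (h3 : G.IsSubcubic) {k : ℕ} (hk : 1 ≤ k) (hF : (k - 1) * (4 * (k - 1)) + 2 < F.card) :
    ∃ (x y : V) (p : G.Walk x y) (J : Finset ℕ), p.IsPath ∧ J ⊆ F ∧ k ≤ J.card ∧
      ∀ t ∈ J, e t ∈ p.edges := by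
  have h0 := h.card_filter_eq_zero_le h3
  have hcard := Finset.card_filter_add_card_filter_not (s := F) (fun t => a t = 0)
  have hsub : (F.filter fun t => ¬ a t = 0) ⊆ F := Finset.filter_subset _ _
  have h' := h.mono hsub
  have hinj : InjOn a (F.filter fun t => ¬ a t = 0 : Finset ℕ) := by
    intro t ht u hu htu
    simp only [Finset.coe_filter, mem_ofPred_eq] at ht hu
    exact h.eq_of_adj h3 (Nat.pos_of_ne_zero ht.2) ((h.lt t ht.1).trans (h.le t ht.1)) ht.1 hu.1
      (h.adj_bot t ht.1) (htu ▸ h.adj_bot u hu.1)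
  obtain ⟨i, j, I, J, hJ, hJk, hR⟩ := Route.exists_of_card h'.lt (fun t ht => (h'.le t ht).le)
    hinj hk (by omega)
  obtain ⟨p, hp, -, hpe⟩ := h'.exists_isPath hR
  exact ⟨_, _, p, J, hp, hJ.trans hsub, hJk, hpe⟩

end Chorded

end SimpleGraph

/-! ### Lengthening the path, and counting marked edges -/

namespace SimpleGraph

section Extend

variable {V : Type*} {G : SimpleGraph V} {v : ℕ → V} {m n : ℕ} {F : Finset ℕ}
  {a : ℕ → ℕ} {K : ℕ → Set V} {e : ℕ → Sym2 V}

theorem IsChordedPath.extend (h : G.IsChordedPath v n F a K e) {x : V} (hx : ∀ i ≤ n, x ≠ v i)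
    (hadj : G.Adj (v n) x) (hK : ∀ t ∈ F, x ∉ K t) :
    G.IsChordedPath (Function.update v (n + 1) x) (n + 1) F a K e := by
  have hv : ∀ i ≤ n, Function.update v (n + 1) x i = v i := fun i hi =>
    Function.update_of_ne (by omega) _ _
  have hvt : ∀ t ∈ F, Function.update v (n + 1) x t = v t := fun t ht => hv t (h.le t ht).le
  have hva : ∀ t ∈ F, Function.update v (n + 1) x (a t) = v (a t) := fun t ht =>
    hv _ ((h.lt t ht).trans (h.le t ht)).le
  have hvx : Function.update v (n + 1) x (n + 1) = x := Function.update_self _ _ _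
  constructor
  · intro i hi j hj hij
    rcases Nat.le_succ_iff.1 hi with hi | rfl <;> rcases Nat.le_succ_iff.1 hj with hj | rfl
    · rw [hv i hi, hv j hj] at hij
      exact h.injOn hi hj hij
    · rw [hv i hi, hvx] at hij
      exact (hx i hi hij.symm).elim
    · rw [hv j hj, hvx] at hij
      exact (hx j hj hij).elim
    · rfl
  · intro i hi
    rcases Nat.lt_succ_iff_lt_or_eq.1 hi with hi | rfl
    · rw [hv i hi.le, hv (i + 1) hi]
      exact h.adj i hi
    · rw [hv i le_rfl, hvx]
      exact hadj
  · exact h.lt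
  · exact fun t ht => (h.le t ht).trans (Nat.lt_succ_self n)
  · intro t ht i hi
    rcases Nat.le_succ_iff.1 hi with hi | rfl
    · rw [hv i hi]
      exact h.notMem t ht i hi
    · rw [hvx]
      exact hK t ht
  · exact h.disjoint
  · intro t ht
    rw [hvt t ht, hva t ht]
    exact h.ear t ht
  · intro t ht
    rw [hvt t ht]
    exact h.adj_top t ht
  · intro t ht
    rw [hva t ht]
    exact h.adj_bot t ht
  · exact h.meets

theorem IsChordedPath.insert (h : G.IsChordedPath v m F a K e) (hn : n < m) (hnF : n ∉ F)
    {j : ℕ} (hj : j < n) {T : Set V} {e₀ : Sym2 V} (hT : ∀ i ≤ m, v i ∉ T)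
    (hdisj : ∀ t ∈ F, Disjoint (K t) T)
    (hear : ∃ p : G.Walk (v n) (v j), p.IsPath ∧
      (∀ s ∈ p.support, s = v n ∨ s = v j ∨ s ∈ T) ∧ e₀ ∈ p.edges)
    (htop : ∃ s ∈ T, G.Adj (v n) s) (hbot : ∃ s ∈ T, G.Adj (v j) s) (hm : ∃ s ∈ T, s ∈ e₀) :
    G.IsChordedPath v m (insert n F) (Function.update a n j) (Function.update K n T)
      (Function.update e n e₀) := by
  have hne : ∀ t ∈ F, t ≠ n := fun t ht h => hnF (h ▸ ht)
  refine ⟨h.injOn, h.adj, ?_, ?_, ?_, ?_, ?_, ?_, ?_, ?_⟩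
  · intro t ht
    rcases Finset.mem_insert.1 ht with rfl | ht
    · simpa using hj
    · simpa [hne t ht] using h.lt t ht
  · intro t ht
    rcases Finset.mem_insert.1 ht with rfl | ht
    · exact hn
    · exact h.le t ht
  · intro t ht
    rcases Finset.mem_insert.1 ht with rfl | ht
    · simpa using hT
    · simpa [hne t ht] using h.notMem t ht
  · intro t ht u hu htu
    rcases Finset.mem_insert.1 ht with ht' | ht' <;> rcases Finset.mem_insert.1 hu with hu' | hu'
    · exact (htu (ht'.trans hu'.symm)).elim
    · simpa [ht', hne u hu'] using (hdisj u hu').symm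
    · simpa [hu', hne t ht'] using hdisj t ht'
    · simpa [hne t ht', hne u hu'] using h.disjoint t ht' u hu' htu
  · intro t ht
    rcases Finset.mem_insert.1 ht with rfl | ht
    · rw [Function.update_self, Function.update_self, Function.update_self]
      exact hear
    · rw [Function.update_of_ne (hne t ht), Function.update_of_ne (hne t ht),
        Function.update_of_ne (hne t ht)]
      exact h.ear t ht
  · intro t ht
    rcases Finset.mem_insert.1 ht with rfl | ht
    · simpa only [Function.update_self] using htop
    · simpa only [Function.update_of_ne (hne t ht)] using h.adj_top t ht
  · intro t ht
    rcases Finset.mem_insert.1 ht with rfl | ht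
    · simpa only [Function.update_self] using hbot
    · simpa only [Function.update_of_ne (hne t ht)] using h.adj_bot t ht
  · intro t ht
    rcases Finset.mem_insert.1 ht with rfl | ht
    · simpa only [Function.update_self] using hm
    · simpa only [Function.update_of_ne (hne t ht)] using h.meets t ht

end Extend

/-- Take `t` to be the vertex that follows the last visit to `y`. -/
theorem exists_adj_of_mem_reachIn {V : Type*} {G : SimpleGraph V} {D : Set V} {y z : V}
    (hz : z ∈ G.reachIn D y) (hne : z ≠ y) :
    ∃ t, G.Adj y t ∧ t ∈ D \ {y} ∧ z ∈ G.reachIn (D \ {y}) t := by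
  have key : ∀ (u z : V) (p : G.Walk u z), (∀ s ∈ p.support, s ∈ D) → z ≠ y →
      z ∈ G.reachIn (D \ {y}) u ∨ ∃ t, G.Adj y t ∧ t ∈ D \ {y} ∧ z ∈ G.reachIn (D \ {y}) t := by
    intro u z p
    induction p with
    | nil => exact fun h hne => Or.inl (mem_reachIn_self ⟨h _ (by simp), hne⟩)
    | @cons u w z h p ih =>
      intro hp hne
      simp only [Walk.support_cons, List.mem_cons, forall_eq_or_imp] at hp
      rcases ih hp.2 hne with hz | hz
      · have hwD : w ∈ D \ {y} := reachIn_subset (reachIn_symm hz)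
        by_cases huy : u = y
        · subst huy
          exact Or.inr ⟨w, h, hwD, hz⟩
        · exact Or.inl (reachIn_trans
            (reachIn_of_adj (mem_reachIn_self (show u ∈ D \ {y} from ⟨hp.1, huy⟩)) h hwD) hz)
      · exact Or.inr hz
  obtain ⟨p, hp⟩ := hz
  rcases key y z p hp hne with h | h
  · exact ((reachIn_subset (reachIn_symm h)).2 rfl).elim
  · exact h

open Classical in
/-- The number of edges of `S` with both ends in `Z`. -/
noncomputable def countIn {V : Type*} (S : Finset (Sym2 V)) (Z : Set V) : ℕ :=
  (S.filter fun e => ∀ w ∈ e, w ∈ Z).card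

theorem countIn_eq_card_filter {V : Type*} (S : Finset (Sym2 V)) (Z : Set V)
    [DecidablePred fun e : Sym2 V => ∀ w ∈ e, w ∈ Z] :
    countIn S Z = (S.filter fun e => ∀ w ∈ e, w ∈ Z).card := by
  unfold countIn
  congr!

theorem exists_mem_of_countIn_pos {V : Type*} {S : Finset (Sym2 V)} {Z : Set V}
    (h : 0 < countIn S Z) : ∃ e ∈ S, ∀ w ∈ e, w ∈ Z := by
  classical
  obtain ⟨e, he⟩ := Finset.card_pos.1 h
  exact ⟨e, (Finset.mem_filter.1 he).1, (Finset.mem_filter.1 he).2⟩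

open Classical in
/-- The number of edges of `S` on the path `v 0, …, v n`. -/
noncomputable def countAlong {V : Type*} (S : Finset (Sym2 V)) (v : ℕ → V) (n : ℕ) : ℕ :=
  ((Finset.range n).filter fun i => s(v i, v (i + 1)) ∈ S).card

theorem countAlong_update {V : Type*} (S : Finset (Sym2 V)) (v : ℕ → V) (n : ℕ) (x : V) :
    countAlong S v n ≤ countAlong S (Function.update v (n + 1) x) (n + 1) ∧
      (s(v n, x) ∈ S →
        countAlong S v n + 1 ≤ countAlong S (Function.update v (n + 1) x) (n + 1)) := by
  classical
  have h : (Finset.range n).filter (fun i => s(Function.update v (n + 1) x i,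
      Function.update v (n + 1) x (i + 1)) ∈ S) =
      (Finset.range n).filter fun i => s(v i, v (i + 1)) ∈ S := by
    refine Finset.filter_congr fun i hi => ?_
    rw [Finset.mem_range] at hi
    rw [Function.update_of_ne (by omega), Function.update_of_ne (by omega)]
  unfold countAlong
  rw [Finset.range_add_one, Finset.filter_insert, Function.update_of_ne (by omega),
    Function.update_self]
  constructor
  · split_ifs
    · rw [Finset.card_insert_of_notMem (by simp), h]
      exact Nat.le_succ _
    · rw [h]
  · intro hx
    rw [if_pos hx, Finset.card_insert_of_notMem (by simp), h]

section Count

variable {V : Type*} {G : SimpleGraph V} {S : Finset (Sym2 V)} {D : Set V} {y₀ x y : V}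

/-- An edge that avoids `y₀` survives its deletion and is reached through one of the neighbours of
`y₀`. -/
theorem mem_reachIn_cases (hxy : ∀ t ∈ D, G.Adj y₀ t → t = x ∨ t = y) {e : Sym2 V}
    (he : e ∈ G.edgeSet) (heH : ∀ w ∈ e, w ∈ G.reachIn D y₀) :
    (∀ w ∈ e, w ∈ G.reachIn (D \ {y₀}) x) ∨ (∀ w ∈ e, w ∈ G.reachIn (D \ {y₀}) y) ∨
      e = s(y₀, x) ∨ e = s(y₀, y) := by
  induction e with
  | h p q =>
    have hpq : G.Adj p q := he
    have hp := heH p (by simp)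
    have hq := heH q (by simp)
    by_cases hpy : p = y₀
    · subst hpy
      rcases hxy q (reachIn_subset hq) hpq with rfl | rfl <;> simp
    by_cases hqy : q = y₀
    · subst hqy
      rcases hxy p (reachIn_subset hp) hpq.symm with rfl | rfl <;> simp [Sym2.eq_swap]
    obtain ⟨t, hyt, htD, hpt⟩ := exists_adj_of_mem_reachIn hp hpy
    have hqt := reachIn_of_adj hpt hpq ⟨reachIn_subset hq, hqy⟩
    rcases hxy t htD.1 hyt with rfl | rfl
    · exact Or.inl (by simp [hpt, hqt])
    · exact Or.inr (Or.inl (by simp [hpt, hqt]))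

theorem countIn_le (hS : ∀ e ∈ S, e ∈ G.edgeSet)
    (hxy : ∀ t ∈ D, G.Adj y₀ t → t = x ∨ t = y) :
    countIn S (G.reachIn D y₀) ≤
      countIn S (G.reachIn (D \ {y₀}) x) + countIn S (G.reachIn (D \ {y₀}) y) + 2 := by
  classical
  unfold countIn
  refine (Finset.card_le_card (t := (S.filter fun e => ∀ w ∈ e, w ∈ G.reachIn (D \ {y₀}) x) ∪
    (S.filter fun e => ∀ w ∈ e, w ∈ G.reachIn (D \ {y₀}) y) ∪ {s(y₀, x), s(y₀, y)}) ?_).trans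
    ((Finset.card_union_le _ _).trans
      (add_le_add (Finset.card_union_le _ _) Finset.card_le_two))
  intro e he
  rw [Finset.mem_filter] at he
  simp only [Finset.mem_union, Finset.mem_filter, he.1, true_and, Finset.mem_insert,
    Finset.mem_singleton]
  have := mem_reachIn_cases hxy (hS e he.1) he.2
  tauto

theorem countIn_le_of_notMem (hS : ∀ e ∈ S, e ∈ G.edgeSet)
    (hxy : ∀ t ∈ D, G.Adj y₀ t → t = x ∨ t = y) (hx : s(y₀, x) ∉ S) (hy : s(y₀, y) ∉ S)
    (hY : countIn S (G.reachIn (D \ {y₀}) y) = 0 ∨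
      G.reachIn (D \ {y₀}) y ⊆ G.reachIn (D \ {y₀}) x) :
    countIn S (G.reachIn D y₀) ≤ countIn S (G.reachIn (D \ {y₀}) x) := by
  classical
  refine Finset.card_le_card fun e he => ?_
  rw [Finset.mem_filter] at he ⊢
  refine ⟨he.1, ?_⟩
  rcases mem_reachIn_cases hxy (hS e he.1) he.2 with h | h | rfl | rfl
  · exact h
  · rcases hY with hY | hY
    · rw [countIn, Finset.card_eq_zero, Finset.filter_eq_empty_iff] at hY
      exact (hY he.1 h).elim
    · exact fun w hw => hY (h w hw)
  · exact (hx he.1).elim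
  · exact (hy he.1).elim

end Count

/-! ### The greedy search -/

/-- A stage of the search: a path `v 0, …, v n` with chords for `t ∈ F`, each carrying an edge of `S`, such that
the unexplored part that contains `v n` still holds many edges of `S`. -/
structure IsSearch {V : Type*} (G : SimpleGraph V) (S : Finset (Sym2 V)) (v : ℕ → V) (n : ℕ)
    (F : Finset ℕ) (a : ℕ → ℕ) (K : ℕ → Set V) (e : ℕ → Sym2 V) : Prop where
  isChordedPath : G.IsChordedPath v n F a K e
  pos : 0 < n
  disjoint : ∀ t ∈ F, Disjoint (K t) (G.reachIn (v '' Iio n)ᶜ (v n))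
  mem : ∀ t ∈ F, e t ∈ S
  card_le : S.card ≤ 2 ^ (F.card + countAlong S v n) * (countIn S (G.reachIn (v '' Iio n)ᶜ (v n)) + 3)

section Search

variable {V : Type*} {G : SimpleGraph V} {S : Finset (Sym2 V)} {v : ℕ → V} {n : ℕ}
  {F : Finset ℕ} {a : ℕ → ℕ} {K : ℕ → Set V} {e : ℕ → Sym2 V}

theorem compl_image_Iio_update (v : ℕ → V) (n : ℕ) (x : V) :
    (Function.update v (n + 1) x '' Iio (n + 1))ᶜ = (v '' Iio n)ᶜ \ {v n} := by
  have : Function.update v (n + 1) x '' Iio (n + 1) = v '' Iio (n + 1) :=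
    image_congr fun i hi => Function.update_of_ne (ne_of_lt hi) _ _
  rw [this]
  ext w
  simp only [mem_compl_iff, mem_image, mem_Iio, mem_sdiff, mem_singleton_iff, not_exists, not_and]
  constructor
  · exact fun h => ⟨fun i hi => h i (by omega), fun hw => h n (by omega) hw.symm⟩
  · rintro ⟨h1, h2⟩ i hi
    rcases Nat.lt_succ_iff_lt_or_eq.1 hi with hi | rfl
    · exact h1 i hi
    · exact fun hw => h2 hw.symm

theorem mem_compl_image_diff {w : V} :
    w ∈ (v '' Iio n)ᶜ \ {v n} ↔ ∀ i ≤ n, w ≠ v i := by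
  simp only [mem_compl_iff, mem_image, mem_Iio, mem_sdiff, mem_singleton_iff, not_exists, not_and]
  constructor
  · rintro ⟨h1, h2⟩ i hi rfl
    rcases hi.lt_or_eq with hi | rfl
    · exact h1 i hi rfl
    · exact h2 rfl
  · exact fun h => ⟨fun i hi hw => h i hi.le hw.symm, h n le_rfl⟩

theorem IsSearch.mem_compl_image (h : G.IsSearch S v n F a K e) : v n ∈ (v '' Iio n)ᶜ := by
  rintro ⟨i, hi, hv⟩
  exact ne_of_lt hi (h.isChordedPath.injOn (mem_Iic.2 (le_of_lt hi)) (mem_Iic.2 le_rfl) hv)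

theorem IsSearch.reachIn_subset (h : G.IsSearch S v n F a K e) {x : V} (hadj : G.Adj (v n) x)
    (hx : x ∈ (v '' Iio n)ᶜ \ {v n}) :
    G.reachIn ((v '' Iio n)ᶜ \ {v n}) x ⊆ G.reachIn (v '' Iio n)ᶜ (v n) := fun _ hz =>
  reachIn_trans (reachIn_of_adj (mem_reachIn_self h.mem_compl_image) hadj hx.1)
    (reachIn_mono sdiff_subset _ hz)

/-- The `+ 3` in `card_le` absorbs the additive loss: `c ≤ 2 c' + 2` gives `c + 3 ≤ 2 (c' + 3)`. The
factor `2` is paid for by the marked edge just traversed. -/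
theorem IsSearch.extend (h : G.IsSearch S v n F a K e) {x : V} (hadj : G.Adj (v n) x)
    (hx : x ∈ (v '' Iio n)ᶜ \ {v n})
    (hc : countIn S (G.reachIn (v '' Iio n)ᶜ (v n)) ≤
        countIn S (G.reachIn ((v '' Iio n)ᶜ \ {v n}) x) ∨
      s(v n, x) ∈ S ∧ countIn S (G.reachIn (v '' Iio n)ᶜ (v n)) ≤
        2 * countIn S (G.reachIn ((v '' Iio n)ᶜ \ {v n}) x) + 2) :
    G.IsSearch S (Function.update v (n + 1) x) (n + 1) F a K e := by
  have hxH := h.reachIn_subset hadj hx (mem_reachIn_self hx)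
  have hupd := countAlong_update S v n x
  refine ⟨h.isChordedPath.extend (mem_compl_image_diff.1 hx) hadj
    fun t ht hxt => (h.disjoint t ht).le_bot ⟨hxt, hxH⟩, by omega, fun t ht => ?_, h.mem, ?_⟩
  · rw [compl_image_Iio_update, Function.update_self]
    exact (h.disjoint t ht).mono_right (h.reachIn_subset hadj hx)
  · rw [compl_image_Iio_update, Function.update_self]
    refine h.card_le.trans ?_
    rcases hc with hc | ⟨hxS, hc⟩
    · exact Nat.mul_le_mul (Nat.pow_le_pow_right (by omega) (by omega)) (by omega)
    · calc _ ≤ 2 ^ (F.card + countAlong S v n) *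
            (2 * (countIn S (G.reachIn ((v '' Iio n)ᶜ \ {v n}) x) + 3)) :=
            Nat.mul_le_mul le_rfl (by omega)
        _ = 2 ^ (F.card + countAlong S v n + 1) *
            (countIn S (G.reachIn ((v '' Iio n)ᶜ \ {v n}) x) + 3) := by ring
        _ ≤ _ := Nat.mul_le_mul (Nat.pow_le_pow_right (by omega) (by have := hupd.2 hxS; omega)) le_rfl

/-- Here the halving is paid for by a new chord at `n`. Its ear runs through the abandoned component
of `y`, which is disjoint from the older interiors and from everything explored later. -/
theorem IsSearch.extend_chord [Fintype V] (hG : G.IsTwoConnected) (hS : ∀ e ∈ S, e ∈ G.edgeSet)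
    (h : G.IsSearch S v n F a K e) {x y : V} (hadj : G.Adj (v n) x)
    (hx : x ∈ (v '' Iio n)ᶜ \ {v n}) (hadjy : G.Adj (v n) y) (hy : y ∈ (v '' Iio n)ᶜ \ {v n})
    (hxy : Disjoint (G.reachIn ((v '' Iio n)ᶜ \ {v n}) y) (G.reachIn ((v '' Iio n)ᶜ \ {v n}) x))
    (hc : countIn S (G.reachIn (v '' Iio n)ᶜ (v n)) ≤
        2 * countIn S (G.reachIn ((v '' Iio n)ᶜ \ {v n}) x) + 2)
    (hY : 0 < countIn S (G.reachIn ((v '' Iio n)ᶜ \ {v n}) y) ∨ s(v n, y) ∈ S) :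
    ∃ F' a' K' e', G.IsSearch S (Function.update v (n + 1) x) (n + 1) F' a' K' e' := by
  classical
  set D : Set V := (v '' Iio n)ᶜ \ {v n} with hD
  have hxH := h.reachIn_subset hadj hx (mem_reachIn_self hx)
  have hyH := h.reachIn_subset hadjy hy
  obtain ⟨e₀, he₀S, he₀⟩ : ∃ e₀ ∈ S, e₀ = s(v n, y) ∨ ∀ w ∈ e₀, w ∈ G.reachIn D y := by
    rcases hY with hY | hY
    · obtain ⟨e₀, he₀S, he₀⟩ := exists_mem_of_countIn_pos hY
      exact ⟨e₀, he₀S, Or.inr he₀⟩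
    · exact ⟨_, hY, Or.inl rfl⟩
  have hvD : v n ∉ D := fun h => h.2 rfl
  have hAD : Disjoint D (v '' Iio n) := Set.disjoint_left.2 fun w hw => hw.1
  have hmeet : ∃ s ∈ G.reachIn D y, s ∈ e₀ := by
    rcases he₀ with rfl | he₀
    · exact ⟨y, mem_reachIn_self hy, by simp⟩
    · exact ⟨_, he₀ _ e₀.out_fst_mem, e₀.out_fst_mem⟩
  obtain ⟨b, p, hp, hpe⟩ := hG.exists_isEar (A := v '' Iio n) h.mem_compl_image
    ⟨_, mem_image_of_mem v (mem_Iio.2 h.pos)⟩ (fun w => by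
      by_cases h1 : w = v n
      · exact Or.inr (Or.inl h1)
      · by_cases h2 : w ∈ v '' Iio n
        · exact Or.inr (Or.inr h2)
        · exact Or.inl ⟨h2, h1⟩) hvD hAD hy hadjy (hS e₀ he₀S) he₀
  obtain ⟨s, hsT, hse⟩ := hmeet
  -- The chord has to occupy a neighbour of its lower end inside its own interior; the degree bound
  -- is applied there.
  obtain ⟨z, hz, hzb⟩ := hp.exists_adj_end (hAD.mono_left SimpleGraph.reachIn_subset)
    (fun h => hvD (SimpleGraph.reachIn_subset h)) (p.mem_support_of_mem_edges hpe hse) hsT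
  obtain ⟨j, hj, rfl⟩ := hp.mem
  have hnF : n ∉ F := fun hn => lt_irrefl n (h.isChordedPath.le n hn)
  have hupd := countAlong_update S v n x
  have hv : ∀ i ≤ n, Function.update v (n + 1) x i = v i := fun i hi =>
    Function.update_of_ne (by omega) _ _
  have hvx : Function.update v (n + 1) x (n + 1) = x := Function.update_self _ _ _
  have hchord := (h.isChordedPath.extend (mem_compl_image_diff.1 hx) hadj
    fun t ht hxt => (h.disjoint t ht).le_bot ⟨hxt, hxH⟩).insert (n := n) (j := j)
    (T := G.reachIn D y) (e₀ := e₀) (Nat.lt_succ_self n) hnF hj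
    (fun i hi hiT => by
      rcases Nat.le_succ_iff.1 hi with hi | rfl
      · rw [hv i hi] at hiT
        exact mem_compl_image_diff.1 (SimpleGraph.reachIn_subset hiT) i hi rfl
      · rw [hvx] at hiT
        exact hxy.le_bot ⟨hiT, mem_reachIn_self hx⟩)
    (fun t ht => (h.disjoint t ht).mono_right hyH)
    (by
      rw [hv n le_rfl, hv j (le_of_lt hj)]
      exact ⟨p, hp.isPath, hp.support, hpe⟩)
    ⟨y, mem_reachIn_self hy, by rwa [hv n le_rfl]⟩
    ⟨z, hz, by rw [hv j (le_of_lt hj)]; exact hzb.symm⟩ ⟨s, hsT, hse⟩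
  have hne : ∀ t ∈ F, t ≠ n := fun t ht h => hnF (h ▸ ht)
  refine ⟨_, _, _, _, hchord, by omega, fun t ht => ?_, fun t ht => ?_, ?_⟩
  · rw [compl_image_Iio_update, Function.update_self]
    rcases Finset.mem_insert.1 ht with rfl | ht
    · rw [Function.update_self]
      exact hxy
    · rw [Function.update_of_ne (hne t ht)]
      exact (h.disjoint t ht).mono_right (h.reachIn_subset hadj hx)
  · rcases Finset.mem_insert.1 ht with rfl | ht
    · rwa [Function.update_self]
    · rw [Function.update_of_ne (hne t ht)]
      exact h.mem t ht
  · rw [compl_image_Iio_update, Function.update_self, Finset.card_insert_of_notMem hnF]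
    refine h.card_le.trans ?_
    calc _ ≤ 2 ^ (F.card + countAlong S v n) * (2 * (countIn S (G.reachIn D x) + 3)) :=
            Nat.mul_le_mul le_rfl (by omega)
        _ = 2 ^ (F.card + 1 + countAlong S v n) * (countIn S (G.reachIn D x) + 3) := by ring
        _ ≤ _ := Nat.mul_le_mul (Nat.pow_le_pow_right (by omega) (by omega)) le_rfl

variable [Fintype V] [DecidableRel G.Adj]

theorem IsSearch.exists_neighbors (h3 : G.IsSubcubic) (hS : ∀ e ∈ S, e ∈ G.edgeSet)
    (h : G.IsSearch S v n F a K e) (hpos : 0 < countIn S (G.reachIn (v '' Iio n)ᶜ (v n))) :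
    ∃ x y, (G.Adj (v n) x ∧ x ∈ (v '' Iio n)ᶜ \ {v n}) ∧
      (G.Adj (v n) y ∧ y ∈ (v '' Iio n)ᶜ \ {v n}) ∧
      ∀ t ∈ (v '' Iio n)ᶜ, G.Adj (v n) t → t = x ∨ t = y := by
  classical
  obtain ⟨l, rfl⟩ : ∃ l, n = l + 1 := ⟨n - 1, by have := h.pos; omega⟩
  set D : Set V := (v '' Iio (l + 1))ᶜ with hD
  set N : Finset V := (G.neighborFinset (v (l + 1))).filter fun t => t ∈ D with hN
  have hNmem : ∀ t, t ∈ N ↔ G.Adj (v (l + 1)) t ∧ t ∈ D := by simp [hN]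
  have hprev : v l ∉ D := fun h => h ⟨l, mem_Iio.2 (Nat.lt_succ_self l), rfl⟩
  have hcard : N.card ≤ 2 := by
    have hsub : N ⊆ (G.neighborFinset (v (l + 1))).erase (v l) := by
      intro t ht
      rw [hNmem] at ht
      rw [Finset.mem_erase, mem_neighborFinset]
      exact ⟨fun h => hprev (h ▸ ht.2), ht.1⟩
    have := Finset.card_le_card hsub
    rw [Finset.card_erase_of_mem, card_neighborFinset_eq_degree] at this
    · have := h3 (v (l + 1))
      omega
    · rw [mem_neighborFinset]
      exact (h.isChordedPath.adj l (Nat.lt_succ_self l)).symm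
  have hne : N.Nonempty := by
    obtain ⟨e₀, he₀⟩ := exists_mem_of_countIn_pos hpos
    obtain ⟨z, hz, hzv⟩ : ∃ z ∈ G.reachIn D (v (l + 1)), z ≠ v (l + 1) := by
      induction e₀ with
      | h p q =>
        have hpq : G.Adj p q := hS _ he₀.1
        by_cases hp : p = v (l + 1)
        · exact ⟨q, he₀.2 q (by simp), fun hq => hpq.ne (hp.trans hq.symm)⟩
        · exact ⟨p, he₀.2 p (by simp), hp⟩
    obtain ⟨t, ht, htD, -⟩ := exists_adj_of_mem_reachIn hz hzv
    exact ⟨t, (hNmem t).2 ⟨ht, htD.1⟩⟩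
  obtain ⟨x, y, hxN, hyN, hxy⟩ : ∃ x y, x ∈ N ∧ y ∈ N ∧ ∀ t ∈ N, t = x ∨ t = y := by
    have := hne.card_pos
    rcases (by omega : N.card = 1 ∨ N.card = 2) with h | h
    · obtain ⟨x, hx⟩ := Finset.card_eq_one.1 h
      exact ⟨x, x, by simp [hx], by simp [hx], by simp [hx]⟩
    · obtain ⟨x, y, -, hx⟩ := Finset.card_eq_two.1 h
      exact ⟨x, y, by simp [hx], by simp [hx], by simp [hx]⟩
  have hmem : ∀ t ∈ N, G.Adj (v (l + 1)) t ∧ t ∈ D \ {v (l + 1)} := fun t ht =>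
    ⟨((hNmem t).1 ht).1, ((hNmem t).1 ht).2, fun h => ((hNmem t).1 ht).1.ne h.symm⟩
  exact ⟨x, y, hmem x hxN, hmem y hyN, fun t ht hadj => hxy t ((hNmem t).2 ⟨hadj, ht⟩)⟩

/-- Let `x` lead to the richer piece. If the edge to `x` is marked, traverse it. If `x` and `y`
share a component, traverse the edge to `y` when it is marked and otherwise move to `x` at no loss.
If the components differ, either the side of `y` holds a marked edge and gives a chord, or nothing
is lost by abandoning it. -/
theorem IsSearch.exists_succ (hG : G.IsTwoConnected) (h3 : G.IsSubcubic)
    (hS : ∀ e ∈ S, e ∈ G.edgeSet) (h : G.IsSearch S v n F a K e)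
    (hpos : 0 < countIn S (G.reachIn (v '' Iio n)ᶜ (v n))) :
    ∃ v' F' a' K' e', G.IsSearch S v' (n + 1) F' a' K' e' := by
  obtain ⟨x, y, ⟨hadjx, hx⟩, ⟨hadjy, hy⟩, hxy⟩ := h.exists_neighbors h3 hS hpos
  wlog hle : countIn S (G.reachIn ((v '' Iio n)ᶜ \ {v n}) y) ≤
    countIn S (G.reachIn ((v '' Iio n)ᶜ \ {v n}) x) generalizing x y
  · have hyx := fun t ht hadj => (hxy t ht hadj).symm
    apply this y x <;> first | assumption | exact le_of_not_ge hle
  have hc := countIn_le hS hxy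
  by_cases hxS : s(v n, x) ∈ S
  · exact ⟨_, _, _, _, _, h.extend hadjx hx (Or.inr ⟨hxS, by omega⟩)⟩
  by_cases hyx : y ∈ G.reachIn ((v '' Iio n)ᶜ \ {v n}) x
  · have heq : G.reachIn ((v '' Iio n)ᶜ \ {v n}) y = G.reachIn ((v '' Iio n)ᶜ \ {v n}) x :=
      Subset.antisymm (fun z hz => reachIn_trans hyx hz)
        (fun z hz => reachIn_trans (reachIn_symm hyx) hz)
    by_cases hyS : s(v n, y) ∈ S
    · exact ⟨_, _, _, _, _, h.extend hadjy hy (Or.inr ⟨hyS, by rw [heq] at hc ⊢; omega⟩)⟩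
    · exact ⟨_, _, _, _, _, h.extend hadjx hx
        (Or.inl (countIn_le_of_notMem hS hxy hxS hyS (Or.inr heq.le)))⟩
  by_cases hY : 0 < countIn S (G.reachIn ((v '' Iio n)ᶜ \ {v n}) y) ∨ s(v n, y) ∈ S
  · exact ⟨_, h.extend_chord hG hS hadjx hx hadjy hy
      (Set.disjoint_left.2 fun z hz hz' => hyx (reachIn_trans hz' (reachIn_symm hz)))
      (by omega) hY⟩
  · push Not at hY
    exact ⟨_, _, _, _, _, h.extend hadjx hx
      (Or.inl (countIn_le_of_notMem hS hxy hxS hY.2 (Or.inl (by omega))))⟩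

theorem IsSearch.exists_final (hG : G.IsTwoConnected) (h3 : G.IsSubcubic)
    (hS : ∀ e ∈ S, e ∈ G.edgeSet) (h : G.IsSearch S v n F a K e) :
    ∃ v n F a K e, G.IsChordedPath v n F a K e ∧ (∀ t ∈ F, e t ∈ S) ∧
      S.card ≤ 2 ^ (F.card + countAlong S v n) * 3 := by
  -- The search stops because `v` is injective on `n + 1` indices, so `n < |V|`.
  obtain ⟨d, hd⟩ : ∃ d, Fintype.card V ≤ n + d := ⟨_, Nat.le_add_left _ _⟩
  induction d generalizing v n F a K e with
  | zero =>
    have := Finset.card_le_card_of_injOn (s := Finset.Iic n) (t := Finset.univ) v (by simp)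
      (by simpa using h.isChordedPath.injOn)
    rw [Nat.card_Iic, Finset.card_univ] at this
    omega
  | succ d ih =>
    by_cases hpos : 0 < countIn S (G.reachIn (v '' Iio n)ᶜ (v n))
    · obtain ⟨v', F', a', K', e', h'⟩ := h.exists_succ hG h3 hS hpos
      exact ih h' (by omega)
    · refine ⟨v, n, F, a, K, e, h.isChordedPath, h.mem, ?_⟩
      have := h.card_le
      rwa [Nat.eq_zero_of_not_pos hpos, Nat.zero_add] at this

theorem exists_isSearch (hG : G.IsTwoConnected) (h3 : G.IsSubcubic) (hS : ∀ e ∈ S, e ∈ G.edgeSet) :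
    ∃ v, G.IsSearch S v 1 ∅ (fun _ => 0) (fun _ => ∅) (fun _ => s(v 0, v 0)) := by
  classical
  obtain ⟨w⟩ := hG.2.1.nonempty
  have : Nontrivial V := Fintype.one_lt_card_iff_nontrivial.1 (by have := hG.1; omega)
  obtain ⟨u, hwu⟩ := hG.2.1.preconnected.exists_adj_of_nontrivial w
  set v : ℕ → V := fun i => if i = 0 then w else u with hv
  have hD : (v '' Iio 1)ᶜ = {w}ᶜ := by
    ext z
    simp [hv, eq_comm]
  refine ⟨v, ⟨?_, ?_, by simp, by simp, by simp, by simp, by simp, by simp, by simp, by simp⟩,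
    Nat.one_pos, by simp, by simp, ?_⟩
  · intro i hi j hj hij
    have hi := mem_Iic.1 hi
    have hj := mem_Iic.1 hj
    interval_cases i <;> interval_cases j <;> simp [hv, hwu.ne, hwu.ne'] at hij ⊢
  · intro i hi
    obtain rfl : i = 0 := by omega
    simpa [hv] using hwu
  -- Since `G - w` is connected, only the at most three edges at `w` escape the count; the `+ 3`
  -- covers them.
  · have hsub : S ⊆ (S.filter fun e => ∀ z ∈ e, z ∈ G.reachIn (v '' Iio 1)ᶜ (v 1)) ∪
        G.incidenceFinset w := by
      intro e he
      rw [Finset.mem_union, Finset.mem_filter, mem_incidenceFinset]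
      by_cases hw : w ∈ e
      · exact Or.inr ⟨hS e he, hw⟩
      · refine Or.inl ⟨he, fun z hz => ?_⟩
        rw [hD]
        exact hG.mem_reachIn (by simpa [hv] using hwu.ne') fun h => hw (h ▸ hz)
    have hcard := (Finset.card_le_card hsub).trans (Finset.card_union_le _ _)
    rw [card_incidenceFinset_eq_degree] at hcard
    have := h3 w
    calc S.card ≤ 1 * (countIn S (G.reachIn (v '' Iio 1)ᶜ (v 1)) + 3) := by
          rw [countIn_eq_card_filter]
          omega
      _ ≤ _ := Nat.mul_le_mul Nat.one_le_two_pow le_rfl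

end Search

/-! ### Conclusion -/

theorem IsChordedPath.exists_isPath_along {V : Type*} [DecidableEq V] {G : SimpleGraph V}
    {S : Finset (Sym2 V)} {v : ℕ → V} {n : ℕ} {F : Finset ℕ} {a : ℕ → ℕ} {K : ℕ → Set V}
    {e : ℕ → Sym2 V} (h : G.IsChordedPath v n F a K e) :
    ∃ p : G.Walk (v 0) (v n), p.IsPath ∧ countAlong S v n ≤ (p.edges.toFinset ∩ S).card := by
  obtain ⟨p, hp, -, hpe⟩ := exists_isPath_of_adj_succ h.injOn h.adj (Nat.zero_le n) le_rfl
  refine ⟨p, hp, Finset.card_le_card_of_injOn (fun i => s(v i, v (i + 1))) ?_ ?_⟩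
  · intro i hi
    simp only [Finset.coe_filter, Finset.mem_range, mem_ofPred_eq] at hi
    simp only [Finset.coe_inter, mem_inter_iff, Finset.mem_coe, List.mem_toFinset]
    exact ⟨hpe i ⟨Nat.zero_le i, hi.1⟩, hi.2⟩
  · intro i hi j hj hij
    simp only [Finset.coe_filter, Finset.mem_range, mem_ofPred_eq] at hi hj
    have inj : ∀ {l l' : ℕ}, l ≤ n → l' ≤ n → v l = v l' → l = l' := fun hl hl' hll =>
      h.injOn hl hl' hll
    rcases Sym2.eq_iff.1 hij with ⟨h1, -⟩ | ⟨h1, h2⟩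
    · exact inj hi.1.le hj.1.le h1
    · have := inj hi.1.le hj.1 h1
      have := inj hi.1 hj.1.le h2
      omega

end SimpleGraph

theorem mainTheorem6 {V : Type*} [Fintype V] [DecidableEq V]
    (G : SimpleGraph V) [DecidableRel G.Adj]
    (h2 : G.IsTwoConnected) (h3 : G.IsSubcubic)
    (S : Finset (Sym2 V)) (hS : S ⊆ G.edgeFinset)
    (k : ℕ) (hk : 2 ^ (4 * k ^ 2) ≤ S.card) :
    ∃ (u v : V) (P : G.Walk u v), P.IsPath ∧ k ≤ (P.edges.toFinset ∩ S).card := by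
  have hS' : ∀ e ∈ S, e ∈ G.edgeSet := fun e he => SimpleGraph.mem_edgeFinset.1 (hS he)
  obtain ⟨v₀, h₀⟩ := SimpleGraph.exists_isSearch h2 h3 hS'
  obtain ⟨v, n, F, a, K, e, h, heS, hcard⟩ := h₀.exists_final h2 h3 hS'
  by_cases hq : k ≤ SimpleGraph.countAlong S v n
  · obtain ⟨p, hp, hpS⟩ := h.exists_isPath_along (S := S)
    exact ⟨_, _, p, hp, hq.trans hpS⟩
  · obtain ⟨l, rfl⟩ : ∃ l, k = l + 1 := ⟨k - 1, by omega⟩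
    -- The factor `3` left over from the search is less than `2 ^ 2`.
    have hlt : 2 ^ (4 * (l + 1) ^ 2) < 2 ^ (F.card + SimpleGraph.countAlong S v n + 2) := by
      refine (hk.trans hcard).trans_lt ?_
      rw [pow_add _ _ 2]
      exact Nat.mul_lt_mul_of_pos_left (by norm_num) (by positivity)
    have hexp := (Nat.pow_lt_pow_iff_right (by norm_num)).1 hlt
    -- At most `l` marked edges lie on the path, so `|F| > 4 (l + 1)² - 2 - l ≥ 4 l² + 2`.
    have hF : (l + 1 - 1) * (4 * (l + 1 - 1)) + 2 < F.card := by
      rw [Nat.add_sub_cancel]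
      nlinarith
    obtain ⟨x, y, p, J, hp, hJF, hJ, hpe⟩ := h.exists_isPath_of_card h3 (Nat.le_add_left 1 l) hF
    refine ⟨x, y, p, hp, hJ.trans ?_⟩
    refine Finset.card_le_card_of_injOn e ?_ (h.injOn_edge.mono (by exact_mod_cast hJF))
    intro t ht
    simp only [Finset.coe_inter, mem_inter_iff, Finset.mem_coe, List.mem_toFinset]
    exact ⟨hpe t ht, heS t (hJF ht)⟩
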